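/- Let $F|K$ be an algebraic function field, i.e. a finitely generated field extension of transcendence degree $s\ge 1$, in arbitrary characteristic. Let $r$ be an integer with $1\le r\le s$, and let $\Gamma$ be the group $\mathbb{Z}^r$ endowed with an arbitrary (total, translation-invariant) ordering. Let $a_1,\dots,a_m\in F$ be nonzero. For a place $\lambda$ of $F$ with values in an extension field of $K$ such that $\lambda|_K=\mathrm{id}_K$, denote by $F\lambda\supseteq K$ its residue field, i.e. the set of finite values of $\lambda$. Let $v_\lambda$ be an associated valuation (a valuation of $F$ whose valuation ring is $\{a\in F:\lambda(a)\neq\infty\}$; it is determined up to equivalence), and let $v_\lambda F$ be its value group. Two such places $\lambda,\mu$ are equivalent if $\mu=\sigma\circ\lambda$ for some field isomorphism $\sigma:F\lambda\to F\mu$ (with $\sigma(\infty)=\infty$). Then there are infinitely many pairwise nonequivalent places $\lambda$ of $F$ with $\lambda|_K=\mathrm{id}_K$ such that * $F\lambda|K$ is a finite extension, * $v_\lambda$ can be chosen with values in $\Gamma\cup\{\infty\}$ such that $v_\lambda F$ is a subgroup of finite index in $\Gamma$, * $\lambda(a_i)\neq 0,\infty$ for $1\le i\le m$. If in addition $K$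 is existentially closed in $F$ (every existential sentence in the language of rings with parameters from $K$ which holds in $F$ also holds in $K$), then there are infinitely many pairwise nonequivalent places $\lambda$ of $F$ with $\lambda|_K=\mathrm{id}_K$ such that $F\lambda=K$, $v_\lambda$ can be chosen with values in $\Gamma\cup\{\infty\}$ such that $v_\lambda F=\Gamma$, and $\lambda(a_i)\neq 0,\infty$ for $1\le i\le m$. -/

import Mathlib

universe u v w

/-- A place of a field `F` with values in a field `L`: a map `F → L ∪ {∞}` sending `1` to `1` which
is compatible with addition and multiplication wherever the right hand side is defined, under the
conventions `∞ + x = ∞` for `x ∈ L` and `∞ * x = ∞` for `x ∈ L ∪ {∞}`, `x ≠ 0`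
(while `∞ + ∞`, `0 * ∞` are undefined). -/
structure FieldPlace (F : Type v) (L : Type w) [Field F] [Field L] where
  toFun : F → OnePoint L
  map_one : toFun 1 = ((1 : L) : OnePoint L)
  map_add : ∀ (a b : F) (x y : L), toFun a = (x : OnePoint L) → toFun b = (y : OnePoint L) →
    toFun (a + b) = ((x + y : L) : OnePoint L)
  map_mul : ∀ (a b : F) (x y : L), toFun a = (x : OnePoint L) → toFun b = (y : OnePoint L) →
    toFun (a * b) = ((x * y : L) : OnePoint L)
  map_add_infty : ∀ a b : F, toFun a = OnePoint.infty → toFun b ≠ OnePoint.infty →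
    toFun (a + b) = OnePoint.infty
  map_mul_infty : ∀ a b : F, toFun a = OnePoint.infty → toFun b ≠ ((0 : L) : OnePoint L) →
    toFun (a * b) = OnePoint.infty

namespace FieldPlace

variable {F : Type v} {L : Type w} [Field F] [Field L]

instance : CoeFun (FieldPlace F L) (fun _ => F → OnePoint L) := ⟨FieldPlace.toFun⟩

theorem map_inv (p : FieldPlace F L) (a : F) (x : L) (ha : p a = (x : OnePoint L)) (hx : x ≠ 0) :
    p a⁻¹ = ((x⁻¹ : L) : OnePoint L) := by
  have ha0 : a ≠ 0 := by
    rintro rfl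
    have h := p.map_add 0 0 x x ha ha
    rw [add_zero] at h
    have h2 : x = x + x := OnePoint.coe_injective (ha.symm.trans h)
    exact hx (left_eq_add.mp h2)
  have h1 := p.map_one
  cases hb : p.toFun a⁻¹ with
  | infty =>
    have h := p.map_mul_infty a⁻¹ a hb
      (fun h => hx (OnePoint.coe_injective (ha.symm.trans h)))
    rw [inv_mul_cancel₀ ha0, h1] at h
    exact absurd h (OnePoint.coe_ne_infty _)
  | coe y =>
    have h := p.map_mul a a⁻¹ x y ha hb
    rw [mul_inv_cancel₀ ha0, h1] at h
    have h2 : (1 : L) = x * y := OnePoint.coe_injective h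
    rw [eq_inv_of_mul_eq_one_right h2.symm]

end FieldPlace

/-- A point of `S(F|K)`: a place of `F` with values in some extension field of `K` whose restriction
to `K` is the identity. (A residue field of `F` is a quotient of a subring of `F`, so the universe of
`F` contains the residue fields of all such places.) -/
structure PlaceOver (K : Type u) (F : Type v) [Field K] [Field F] [Algebra K F] where
  codomain : Type v
  [instField : Field codomain]
  [instAlgebra : Algebra K codomain]
  place : FieldPlace F codomain
  trivial_on : ∀ c : K, place (algebraMap K F c) =
    ((algebraMap K codomain c : codomain) : OnePoint codomain)

namespace PlaceOver

attribute [instance] PlaceOver.instField PlaceOver.instAlgebra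

variable {K : Type u} {F : Type v} [Field K] [Field F] [Algebra K F]

/-- The residue field `Fλ`, the set of finite values of `λ`, as an extension of `K`. -/
def residueField (p : PlaceOver K F) : IntermediateField K p.codomain where
  carrier := {x | ∃ a : F, p.place a = (x : OnePoint p.codomain)}
  mul_mem' := by
    rintro x y ⟨a, ha⟩ ⟨b, hb⟩
    exact ⟨a * b, p.place.map_mul a b x y ha hb⟩
  add_mem' := by
    rintro x y ⟨a, ha⟩ ⟨b, hb⟩
    exact ⟨a + b, p.place.map_add a b x y ha hb⟩
  algebraMap_mem' c := ⟨algebraMap K F c, p.trivial_on c⟩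
  inv_mem' := by
    rintro x ⟨a, ha⟩
    by_cases hx : x = 0
    · subst hx
      exact ⟨a, by rw [inv_zero]; exact ha⟩
    · exact ⟨a⁻¹, p.place.map_inv a x ha hx⟩

/-- Two places are equivalent if `μ = σ ∘ λ` for an isomorphism `σ` of their residue fields
(where `σ ∞ = ∞`). -/
def Equivalent (p q : PlaceOver K F) : Prop :=
  ∃ σ : p.residueField ≃+* q.residueField,
    (∀ (a : F) (x : p.residueField), p.place a = ((x : p.codomain) : OnePoint p.codomain) →
      q.place a = ((σ x : q.codomain) : OnePoint q.codomain)) ∧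
    ∀ a : F, p.place a = OnePoint.infty → q.place a = OnePoint.infty

/-- `v` is a valuation associated with the place `λ` (these are determined up to equivalence):
its valuation ring is the ring of elements at which `λ` is finite. -/
def IsAssociatedValuation {Γ : Type w} [AddCommGroup Γ] [LinearOrder Γ] [IsOrderedAddMonoid Γ]
    (p : PlaceOver K F) (v : AddValuation F (WithTop Γ)) : Prop :=
  ∀ a : F, 0 ≤ v a ↔ p.place a ≠ OnePoint.infty

end PlaceOver

/-- The value group `vF` of a valuation `v : F → Γ ∪ {∞}`, as a subgroup of `Γ`. -/
def valuedSubgroup {F : Type v} [Field F] {Γ : Type w} [AddCommGroup Γ] [LinearOrder Γ]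
    [IsOrderedAddMonoid Γ] (v : AddValuation F (WithTop Γ)) : AddSubgroup Γ where
  carrier := {γ | ∃ a : F, v a = (γ : WithTop Γ)}
  zero_mem' := ⟨1, by rw [v.map_one]; rfl⟩
  add_mem' := by
    rintro x y ⟨a, ha⟩ ⟨b, hb⟩
    exact ⟨a * b, by rw [v.map_mul, ha, hb]; rfl⟩
  neg_mem' := by
    rintro x ⟨a, ha⟩
    refine ⟨a⁻¹, ?_⟩
    have ha0 : a ≠ 0 := by
      rintro rfl
      rw [v.map_zero] at ha
      exact WithTop.top_ne_coe ha
    have h : v a + v a⁻¹ = 0 := by rw [← v.map_mul, mul_inv_cancel₀ ha0, v.map_one]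
    rw [ha] at h
    cases hb : v a⁻¹ with
    | top =>
      rw [hb, WithTop.add_top] at h
      exact absurd h WithTop.top_ne_zero
    | coe y =>
      rw [hb, ← WithTop.coe_add, WithTop.coe_eq_zero] at h
      rw [eq_neg_of_add_eq_zero_right h]

/-- `F|K` is an algebraic function field: a finitely generated field extension of transcendence
degree at least `1`. -/
def IsAlgebraicFunctionField (K : Type u) (F : Type v) [Field K] [Field F] [Algebra K F] : Prop :=
  (⊤ : IntermediateField K F).FG ∧ 1 ≤ Algebra.trdeg K F

/-- `K` is existentially closed in the extension field `F`: every existential sentence in the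
language of rings with parameters from `K` which holds in `F` also holds in `K`. Such a sentence is
an existential formula whose free variables are indexed by `K`, the variable with index `c` being
interpreted as `c`. -/
def IsExistentiallyClosedIn (K : Type u) (F : Type v) [Field K] [Field F] [Algebra K F] : Prop :=
  letI := FirstOrder.Ring.compatibleRingOfRing K
  letI := FirstOrder.Ring.compatibleRingOfRing F
  ∀ φ : FirstOrder.Language.ring.Formula K, FirstOrder.Language.BoundedFormula.IsExistential φ →
    FirstOrder.Language.Formula.Realize φ (algebraMap K F : K → F) →
    FirstOrder.Language.Formula.Realize φ (fun c : K => c)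

/-! A `K`-embedding of `F` into a Hahn series field `κ((Γ))`, with `κ` finite over `K`, yields a
place by restricting the canonical valuation and the constant coefficient. So it suffices to build
such embeddings with prescribed elements becoming units.

Suppose first that `F = k(x)(y)`, with `x` a transcendence basis and `y` separable over `k(x)`. A
finitely generated algebra `R` is chosen that contains `x` and `y` and in which the derivative of a
cleared minimal polynomial at `y`, and the numerators and denominators of the prescribed elements,
are invertible. A point `R → κ` is a smooth rational specialization. It is deformed by `x i ↦ c i +
z i`, where `c i` is the value of `x i` at the point and the `z i` are algebraically independent
series without constant term, and `y` follows by Hensel's lemma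
(`exists_subalgebra_forall_exists_algHom`). Taking for the first `r` of the `z i` the monomials at a
positive basis `g i` of `Γ` puts every `g i` into the value group. All series live on the monoid `S`
spanned by the `g i`, which is well ordered for every ordering of `Γ`. This makes Hensel's lemma a
recursion and leaves room for further independent series.

If `K` is existentially closed in `F`, then `F|K` is separably generated (MacLane's criterion) and
`R` has a `K`-point, so residue field and value group are as required. In general `F` becomes part
of a separably generated field after a finite extension `k` of constants, and the Nullstellensatz
supplies a point in a finite extension `κ` of `k`. The value group of `F` still contains a multiple
of each `g i`, because `x i - c i` is algebraic over `F` in `κ((Γ))`; hence its index is finite.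

Infinitely many places come from avoidance: each place kills some nonzero `b`, and the next one is
made a unit at all earlier `b`. -/

/-! ### Hahn series on a well-ordered nonnegative monoid: Hensel's lemma and algebraic independence.
-/

section WellOrderedHahnSeries

open HahnSeries

variable {S : Type*} [AddCommMonoid S] [LinearOrder S] [IsOrderedCancelAddMonoid S]
  {k : Type*} [Field k]

/-- The Hahn series over a nonnegative monoid whose coefficients below `g` vanish. -/
def HahnSeries.vanishingIdeal (hS : ∀ s : S, 0 ≤ s) (g : S) : Ideal (HahnSeries S k) where
  carrier := {x | ∀ d < g, x.coeff d = 0}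
  zero_mem' := fun d _ => by simp
  add_mem' := fun {x y} hx hy d hd => by simp [hx d hd, hy d hd]
  smul_mem' := fun c x hx d hd => by
    rw [smul_eq_mul, coeff_mul]
    refine Finset.sum_eq_zero fun ij hij => ?_
    rw [Finset.mem_antidiagonal] at hij
    rw [hx ij.2, mul_zero]
    refine lt_of_le_of_lt ?_ hd
    rw [← hij.2.2]
    exact le_add_of_nonneg_left (hS _)

theorem HahnSeries.coeff_mul_of_vanishing (hS : ∀ s : S, 0 ≤ s) {g : S} {x : HahnSeries S k}
    (hx : ∀ d < g, x.coeff d = 0) (y : HahnSeries S k) :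
    (x * y).coeff g = x.coeff g * y.coeff 0 := by
  rw [coeff_mul]
  refine Finset.sum_eq_single (g, 0) ?_ ?_
  · rintro ⟨i, j⟩ hij hne
    rw [Finset.mem_antidiagonal] at hij
    obtain ⟨-, -, hij⟩ := hij
    simp only at hij ⊢
    have hi : i ≤ g := hij ▸ le_add_of_nonneg_right (hS j)
    rcases hi.lt_or_eq with hi | rfl
    · rw [hx i hi, zero_mul]
    · exact absurd (by rw [show j = 0 by simpa using hij]) hne
  · intro h
    by_contra h0
    refine h ?_
    rw [Finset.mem_antidiagonal]
    exact ⟨left_ne_zero_of_mul h0, right_ne_zero_of_mul h0, add_zero g⟩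

/-- The constant coefficient as a ring homomorphism, for a nonnegative monoid of exponents. -/
def HahnSeries.residueHom (k : Type*) [Field k] (hS : ∀ s : S, 0 ≤ s) : HahnSeries S k →ₐ[k] k where
  toFun x := x.coeff 0
  map_one' := by simp [coeff_one]
  map_mul' x y := coeff_mul_of_vanishing hS (fun d hd => absurd hd (hS d).not_gt) y
  map_zero' := rfl
  map_add' _ _ := rfl
  commutes' c := by simp [HahnSeries.algebraMap_apply]

@[simp]
theorem HahnSeries.residueHom_apply (hS : ∀ s : S, 0 ≤ s) (x : HahnSeries S k) :
    residueHom k hS x = x.coeff 0 := rfl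

/-- The Hahn series with prescribed coefficients, for a well-ordered monoid of exponents. -/
def HahnSeries.ofCoeff [WellFoundedLT S] (f : S → k) : HahnSeries S k :=
  ⟨f, (Set.IsWF.of_wellFoundedLT _).isPWO⟩

-- The hypothesis says that each coefficient of `N X` depends only on strictly smaller coefficients
-- of `X`, so a fixed point is defined coefficient by coefficient by well-founded recursion. No
-- completeness argument is needed.
omit [AddCommMonoid S] [IsOrderedCancelAddMonoid S] in
theorem HahnSeries.exists_fixedPoint [WellFoundedLT S] (N : HahnSeries S k → HahnSeries S k)
    (hN : ∀ X Y : HahnSeries S k, ∀ g, (∀ d < g, X.coeff d = Y.coeff d) →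
      (N X).coeff g = (N Y).coeff g) :
    ∃ Y, N Y = Y := by
  classical
  let y : S → k := WellFounded.fix (wellFounded_lt (α := S)) fun g ih =>
    (N (ofCoeff fun d => if h : d < g then ih d h else 0)).coeff g
  have hy : ∀ g, y g = (N (ofCoeff fun d => if d < g then y d else 0)).coeff g := fun g => by
    rw [show y g = _ from WellFounded.fix_eq _ _ _]
    rfl
  refine ⟨ofCoeff y, HahnSeries.ext (funext fun g => ?_)⟩
  refine Eq.trans ?_ (hy g).symm
  exact hN _ _ _ fun d hd => (if_pos hd).symm

/-- Hensel's lemma: the root is a fixed point of the Newton map whose derivative is frozen at the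
residue `a`. -/
theorem HahnSeries.exists_eval_eq_zero [WellFoundedLT S] (hS : ∀ s : S, 0 ≤ s)
    (p : Polynomial (HahnSeries S k)) (a : k)
    (h0 : (p.map (residueHom k hS : HahnSeries S k →+* k)).eval a = 0)
    (h1 : (p.map (residueHom k hS : HahnSeries S k →+* k)).derivative.eval a ≠ 0) :
    ∃ Y : HahnSeries S k, p.eval Y = 0 ∧ Y.coeff 0 = a := by
  set e := ((p.map (residueHom k hS : HahnSeries S k →+* k)).derivative.eval a)⁻¹ with he
  have he0 : e ≠ 0 := inv_ne_zero h1
  have hres : ∀ (q : Polynomial (HahnSeries S k)) (X : HahnSeries S k), X.coeff 0 = a →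
      (q.eval X).coeff 0 = (q.map (residueHom k hS : HahnSeries S k →+* k)).eval a := by
    intro q X hX
    rw [← hX, ← residueHom_apply hS, ← residueHom_apply hS]
    exact (Polynomial.eval_map_apply (residueHom k hS : HahnSeries S k →+* k) X).symm
  -- `T` resets the constant coefficient to `a`, so that the Newton map makes sense on all series.
  let T : HahnSeries S k → HahnSeries S k := fun X => X + C (a - X.coeff 0)
  have hT : ∀ X, (T X).coeff 0 = a := fun X => by simp [T, HahnSeries.C]
  let N : HahnSeries S k → HahnSeries S k := fun X => T X - C e * p.eval (T X)
  have hN0 : ∀ X, (N X).coeff 0 = a := fun X => by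
    have : (C e * p.eval (T X)).coeff 0 = 0 := by
      rw [C_mul_eq_smul, coeff_smul, hres _ _ (hT X), h0, smul_zero]
    simp only [N, coeff_sub, this, hT, sub_zero]
  obtain ⟨Y, hY⟩ := exists_fixedPoint N (by
    intro X Y g hXY
    obtain ⟨q, hq⟩ := Polynomial.binomExpansion p (T Y) (T X - T Y)
    rw [add_sub_cancel] at hq
    have hh : ∀ d < g, (T X - T Y).coeff d = 0 := by
      intro d hd
      have h2 : X.coeff 0 = Y.coeff 0 := hXY 0 ((hS d).trans_lt hd)
      simp [T, h2, hXY d hd]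
    -- The second factor has constant coefficient `1 - e * e⁻¹ = 0`, and the first vanishes below
    -- `g`, so the product vanishes at `g` too.
    have key : N X - N Y = (T X - T Y) *
        (1 - C e * (p.derivative.eval (T Y) + q * (T X - T Y))) := by
      simp only [N, hq]; ring
    rw [← sub_eq_zero, ← coeff_sub, key, coeff_mul_of_vanishing hS hh, ← residueHom_apply hS (1 - _)]
    have h3 : residueHom k hS (T X - T Y) = 0 := by
      rw [residueHom_apply, coeff_sub, hT, hT, sub_self]
    have h4 : residueHom k hS (C e) = e := by simp [HahnSeries.C]
    have h5 : residueHom k hS (p.derivative.eval (T Y)) = e⁻¹ := by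
      rw [residueHom_apply, hres _ _ (hT Y), he, inv_inv, Polynomial.derivative_map]
    rw [map_sub, map_mul, map_add, map_mul, h3, h4, h5, map_one, mul_zero, add_zero,
      mul_inv_cancel₀ he0, sub_self, mul_zero])
  have hYa : Y.coeff 0 = a := by rw [← hY]; exact hN0 Y
  have hTY : T Y = Y := by simp [T, hYa]
  refine ⟨Y, ?_, hYa⟩
  have : C e * p.eval Y = 0 := by
    have h := hY
    simp only [N, hTY] at h
    exact sub_eq_self.mp h
  rw [C_mul_eq_smul] at this
  exact (smul_eq_zero_iff_right he0).mp this

/-- The elements of `W` vanishing below `n • g` form a descending chain in a finite-dimensional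
space. It stabilizes, and its limit is zero because the multiples of `g` are cofinal. -/
theorem HahnSeries.exists_forall_vanishing (g : S)
    (hg : ∀ s : S, ∃ n : ℕ, s < n • g) (hS : ∀ s : S, 0 ≤ s)
    (W : Submodule k (HahnSeries S k)) [FiniteDimensional k W] :
    ∃ n : ℕ, ∀ m, n ≤ m → ∀ w ∈ W, (∀ d < m • g, w.coeff d = 0) → w = 0 := by
  let U : ℕ → Submodule k W := fun n =>
    ((vanishingIdeal (k := k) hS (n • g)).restrictScalars k).comap W.subtype
  have hmem : ∀ n (w : W), w ∈ U n ↔ ∀ d < n • g, w.1.coeff d = 0 := fun n w => Iff.rfl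
  have hU : Antitone U := fun m n hmn w hw d hd =>
    hw d (hd.trans_le (nsmul_le_nsmul_left (hS g) hmn))
  obtain ⟨n, hn⟩ := IsArtinian.monotone_stabilizes (R := k) (M := W) ⟨fun n => OrderDual.toDual (U n), hU⟩
  refine ⟨n, fun m hm w hw hw0 => ?_⟩
  have hwn : (⟨w, hw⟩ : W) ∈ U n := hU hm ((hmem m ⟨w, hw⟩).mpr hw0)
  refine HahnSeries.ext (funext fun s => ?_)
  obtain ⟨l, hl⟩ := hg s
  have h1 : U n = U (max n l) := hn (max n l) (le_max_left _ _)
  rw [h1, hmem] at hwn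
  exact hwn s (hl.trans_le (nsmul_le_nsmul_left (hS g) (le_max_right _ _)))

theorem MvPolynomial.aeval_sub_aeval_mem {R A σ : Type*} [CommRing R] [CommRing A] [Algebra R A]
    (I : Ideal A) (f h : σ → A) (hfh : ∀ i, f i - h i ∈ I) (Q : MvPolynomial σ R) :
    MvPolynomial.aeval f Q - MvPolynomial.aeval h Q ∈ I := by
  have : (Ideal.Quotient.mkₐ R I).comp (MvPolynomial.aeval f) =
      (Ideal.Quotient.mkₐ R I).comp (MvPolynomial.aeval h) := by
    ext i
    simpa [Ideal.Quotient.mkₐ_eq_mk] using Ideal.Quotient.eq.mpr (hfh i)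
  have h2 := congrArg (fun φ => φ Q) this
  simpa [Ideal.Quotient.mkₐ_eq_mk] using Ideal.Quotient.eq.mp h2

/-- A Liouville-type construction: `y` is a series in multiples of `g` with gaps so large that any
polynomial relation for `y` already holds for almost all of its partial sums. A nonzero one-variable
polynomial cannot have infinitely many roots. -/
theorem HahnSeries.exists_algebraicIndependent_option [WellFoundedLT S] (g : S)
    (hg : ∀ s : S, ∃ n : ℕ, s < n • g) (hS : ∀ s : S, 0 ≤ s) {ι : Type*} [Finite ι]
    (z : ι → HahnSeries S k) (hz : AlgebraicIndependent k z) :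
    ∃ y : HahnSeries S k, y.coeff 0 = 0 ∧
      AlgebraicIndependent k (fun o : Option ι => o.elim y z) := by
  classical
  have hg0 : 0 < g := by
    obtain ⟨n, hn⟩ := hg 0
    refine lt_of_le_of_ne (hS g) fun h => ?_
    rw [← h, smul_zero] at hn
    exact hn.false
  have hmono : StrictMono fun n : ℕ => n • g := nsmul_left_strictMono hg0
  let W : ℕ → HahnSeries S k → Submodule k (HahnSeries S k) := fun d y =>
    (MvPolynomial.restrictTotalDegree (Option ι) k d).map
      (MvPolynomial.aeval fun o : Option ι => o.elim y z).toLinearMap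
  choose b hb using fun (d : ℕ) (y : HahnSeries S k) => exists_forall_vanishing g hg hS (W d y)
  -- Stage `d` holds the last exponent used and the partial sum. The next exponent exceeds the bound
  -- beyond which a nonzero polynomial expression of degree at most `d` in the partial sum and `z`
  -- cannot vanish.
  let st : ℕ → ℕ × HahnSeries S k := fun n => Nat.rec (0, 0)
    (fun d p => (max (b d p.2) p.1 + 1, p.2 + single ((max (b d p.2) p.1 + 1) • g) 1)) n
  have st1 : ∀ d, (st (d + 1)).1 = max (b d (st d).2) (st d).1 + 1 := fun d => rfl
  have st2 : ∀ d, (st (d + 1)).2 = (st d).2 + single ((st (d + 1)).1 • g) 1 := fun d => rfl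
  have hst : StrictMono fun n => (st n).1 := strictMono_nat_of_lt_succ fun d => by
    simp only [st1]; omega
  have hcoe : ∀ d j, d ≤ j → ∀ s < (st (d + 1)).1 • g, (st j).2.coeff s = (st d).2.coeff s := by
    intro d j hdj s hs
    induction j, hdj using Nat.le_induction with
    | base => rfl
    | succ j hj ih =>
      rw [st2, coeff_add, ih, coeff_single_of_ne, add_zero]
      refine (hs.trans_le ?_).ne
      exact hmono.monotone (hst.monotone (Nat.succ_le_succ hj))
  have hinj : Function.Injective fun d => (st d).2 := by
    refine Function.Injective.of_lt_imp_ne fun i j hij h => ?_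
    have h1 := hcoe (i + 1) j hij ((st (i + 1)).1 • g) (hmono (hst (Nat.lt_succ_self (i + 1))))
    rw [← h, st2 i, coeff_add, coeff_single_same] at h1
    exact one_ne_zero (left_eq_add.mp h1)
  choose l hl using hg
  have hidl : ∀ n, n ≤ (st n).1 := fun n => hst.le_apply
  -- The coefficient at `s` no longer changes after stage `l s`, since later terms have exponents
  -- above `l s • g`.
  let y : HahnSeries S k := ofCoeff fun s => (st (l s)).2.coeff s
  have hy : ∀ d, ∀ s < (st (d + 1)).1 • g, y.coeff s = (st d).2.coeff s := by
    intro d s hs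
    have h1 := hcoe (l s) (max d (l s)) (le_max_right _ _) s
      ((hl s).trans_le (hmono.monotone ((Nat.le_succ _).trans (hidl _))))
    rw [← hcoe d (max d (l s)) (le_max_left _ _) s hs, h1]
    rfl
  refine ⟨y, ?_, ?_⟩
  · rw [hy 0 0]
    · rfl
    · have := hmono (hst (Nat.lt_succ_self 0))
      simpa [st] using this
  rw [algebraicIndependent_iff]
  intro Q hQ
  have hvan : ∀ d, Q.totalDegree ≤ d →
      MvPolynomial.aeval (fun o : Option ι => o.elim (st d).2 z) Q = 0 := by
    intro d hd
    refine hb d (st d).2 (st (d + 1)).1 (by rw [st1]; omega) _ ?_ ?_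
    · exact ⟨Q, (MvPolynomial.mem_restrictTotalDegree _ _ _).mpr hd, rfl⟩
    · have := MvPolynomial.aeval_sub_aeval_mem (vanishingIdeal hS ((st (d + 1)).1 • g))
        (fun o : Option ι => o.elim (st d).2 z) (fun o : Option ι => o.elim y z) (by
          rintro (_ | i)
          · intro s hs
            simp [hy d s hs]
          · simp) Q
      rwa [hQ, sub_zero] at this
  let P : Polynomial (HahnSeries S k) := (MvPolynomial.optionEquivLeft k ι Q).map
    (MvPolynomial.aeval z : MvPolynomial ι k →ₐ[k] HahnSeries S k)
  have hP : ∀ x, P.eval x = MvPolynomial.aeval (fun o : Option ι => o.elim x z) Q := by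
    intro x
    have : (((Polynomial.aeval x).restrictScalars k).comp (Polynomial.mapAlgHom
        (MvPolynomial.aeval z : MvPolynomial ι k →ₐ[k] HahnSeries S k))).comp
        (MvPolynomial.optionEquivLeft k ι).toAlgHom =
        MvPolynomial.aeval (fun o : Option ι => o.elim x z) := by
      ext o
      cases o <;> simp
    exact congrArg (fun φ => φ Q) this
  have hP0 : P = 0 := by
    refine Polynomial.eq_zero_of_infinite_isRoot _ ?_
    refine ((Set.Ici_infinite Q.totalDegree).image hinj.injOn).mono ?_
    rintro _ ⟨d, hd, rfl⟩
    exact (hP _).trans (hvan d hd)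
  have := (Polynomial.map_eq_zero_iff hz).mp hP0
  simpa using this

theorem HahnSeries.exists_algebraicIndependent_extension [WellFoundedLT S] (g : S)
    (hg : ∀ s : S, ∃ n : ℕ, s < n • g) (hS : ∀ s : S, 0 ≤ s) {r : ℕ}
    (z : Fin r → HahnSeries S k) (hz : AlgebraicIndependent k z) (hz0 : ∀ i, (z i).coeff 0 = 0)
    (m : ℕ) :
    ∃ w : Fin (r + m) → HahnSeries S k, AlgebraicIndependent k w ∧ (∀ i, (w i).coeff 0 = 0) ∧
      ∀ i, w (Fin.castAdd m i) = z i := by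
  induction m with
  | zero => exact ⟨z, hz, hz0, fun i => rfl⟩
  | succ m ih =>
    obtain ⟨w, hw, hw0, hwz⟩ := ih
    obtain ⟨y, hy0, hy⟩ := exists_algebraicIndependent_option g hg hS w hw
    refine ⟨(fun o : Option (Fin (r + m)) => o.elim y w) ∘ finSuccEquivLast,
      hy.comp _ finSuccEquivLast.injective, ?_, fun i => ?_⟩
    · intro i
      simp only [Function.comp]
      cases finSuccEquivLast i with
      | none => exact hy0
      | some i => exact hw0 i
    · have : Fin.castAdd (m + 1) i = Fin.castSucc (Fin.castAdd m i) := rfl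
      simp [this, hwz]

/-- Distinct monomials in these series sit at distinct exponents, so the coefficients of a
polynomial can be read off from its value. -/
theorem HahnSeries.algebraicIndependent_single {r : ℕ} (g : Fin r → S)
    (hg : Function.Injective fun n : Fin r →₀ ℕ => ∑ i, n i • g i) :
    AlgebraicIndependent k fun i => (single (g i) 1 : HahnSeries S k) := by
  classical
  have hprod : ∀ (n : Fin r →₀ ℕ) (s : Finset (Fin r)),
      ∏ i ∈ s, (single (g i) (1 : k)) ^ n i = single (∑ i ∈ s, n i • g i) 1 := by
    intro n s
    induction s using Finset.induction_on with
    | empty => rfl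
    | insert i s hi ih =>
      rw [Finset.prod_insert hi, Finset.sum_insert hi, ih, single_pow, single_mul_single, one_pow,
        one_mul]
  rw [algebraicIndependent_iff]
  intro Q hQ
  ext n
  have h1 : (MvPolynomial.aeval (fun i => (single (g i) 1 : HahnSeries S k)) Q).coeff
      (∑ i, n i • g i) = Q.coeff n := by
    rw [MvPolynomial.aeval_def, MvPolynomial.eval₂_eq', ← HahnSeries.coeff.addMonoidHom_apply, map_sum]
    rw [Finset.sum_eq_single n]
    · rw [hprod]; simp [algebraMap_apply]
    · intro b _ hb
      have : (∑ i, n i • g i) ≠ ∑ i, b i • g i := fun h => hb (hg h).symm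
      rw [hprod]; simp [algebraMap_apply, coeff_single_of_ne this]
    · intro h
      simp [MvPolynomial.notMem_support_iff.mp h]
  rw [← h1, hQ]
  simp

/-- Translation of the variables by constants is undone by the opposite translation, hence injective
on polynomials. -/
theorem AlgebraicIndependent.algebraMap_add {R A ι : Type*} [CommRing R] [CommRing A] [Algebra R A]
    {z : ι → A} (hz : AlgebraicIndependent R z) (c : ι → R) :
    AlgebraicIndependent R fun i => algebraMap R A (c i) + z i := by
  let τ : (ι → R) → MvPolynomial ι R →ₐ[R] MvPolynomial ι R := fun c =>
    MvPolynomial.aeval fun i => MvPolynomial.C (c i) + MvPolynomial.X i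
  have h1 : (τ fun i => -c i).comp (τ c) = AlgHom.id R _ := by
    ext i : 1
    simp [τ, MvPolynomial.algebraMap_eq]
  have h2 : MvPolynomial.aeval (fun i => algebraMap R A (c i) + z i) =
      (MvPolynomial.aeval z).comp (τ c) := by
    ext i
    simp [τ]
  rw [AlgebraicIndependent, h2]
  rw [AlgHom.coe_comp]
  exact Function.Injective.comp hz 
    (Function.LeftInverse.injective (g := τ fun i => -c i) fun Q => congrArg (fun φ => φ Q) h1)

end WellOrderedHahnSeries

/-! ### Deforming a rational point into an embedding. -/

section HenselianEmbedding

open IntermediateField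
open scoped IntermediateField.algebraAdjoinAdjoin

theorem Polynomial.eval_map_map_of_comp_eq {A B C D : Type*} [CommRing A] [CommRing B]
    [CommRing C] [CommRing D] {f : A →+* B} {g : A →+* C} {f' : B →+* D} {g' : C →+* D}
    (h : f'.comp f = g'.comp g) (q : Polynomial A) (y : C) :
    ((q.map f).map f').eval (g' y) = g' (q.eval₂ g y) := by
  rw [Polynomial.map_map, h, Polynomial.eval_map, Polynomial.hom_eval₂]

theorem Subalgebra.coe_eval₂_inclusion {k Ω : Type*} [CommRing k] [CommRing Ω] [Algebra k Ω]
    {A R : Subalgebra k Ω} (h : A ≤ R) (q : Polynomial A) (y : R) :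
    ((q.eval₂ (Subalgebra.inclusion h : A →+* R) y : R) : Ω) = q.eval₂ (algebraMap A Ω) (y : Ω) :=
  Polynomial.hom_eval₂ q (Subalgebra.inclusion h : A →+* R) (R.val : R →+* Ω) y

/-- A separably generated function field embeds into the field of fractions of a henselian
`κ`-algebra of large enough transcendence degree, once a suitable finitely generated subalgebra has
a `κ`-rational point. -/
theorem exists_subalgebra_forall_exists_algHom {k : Type*} {Ω : Type*} [Field k] [Field Ω]
    [Algebra k Ω] {ι : Type*} [Finite ι] (x : ι → Ω) (hx : AlgebraicIndependent k x) (y : Ω)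
    (hy : IsSeparable (adjoin k (Set.range x)) y) (T : Finset Ω)
    (hT : ∀ a ∈ T, a ≠ 0 ∧ a ∈ (adjoin k (Set.range x))⟮y⟯) :
    ∃ R : Subalgebra k Ω, R.FG ∧
      ∀ {κ : Type*} [Field κ] [Algebra k κ] (_ : R →ₐ[k] κ) {A : Type*} [CommRing A]
        [Algebra κ A] [Algebra k A] [IsScalarTower k κ A] (res : A →ₐ[κ] κ)
        (_ : ∀ (p : Polynomial A) (a : κ), (p.map (res : A →+* κ)).eval a = 0 →
          (p.map (res : A →+* κ)).derivative.eval a ≠ 0 → ∃ Y, p.eval Y = 0 ∧ res Y = a)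
        {H : Type*} [Field H] [Algebra k H] (j : A →ₐ[k] H) (_ : Function.Injective j)
        (z : ι → A) (_ : AlgebraicIndependent κ z) (_ : ∀ i, res (z i) = 0),
        ∃ (Φ : ((adjoin k (Set.range x))⟮y⟯).restrictScalars k →ₐ[k] H) (c : ι → κ),
          (∀ a : ((adjoin k (Set.range x))⟮y⟯).restrictScalars k, (a : Ω) ∈ T →
            ∃ u v : A, res u ≠ 0 ∧ res v ≠ 0 ∧ Φ a = j u / j v) ∧
          ∀ (i : ι) (a : ((adjoin k (Set.range x))⟮y⟯).restrictScalars k), (a : Ω) = x i →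
            Φ a = j (algebraMap κ A (c i) + z i) := by
  classical
  set L := adjoin k (Set.range x) with hL
  let A0 := Algebra.adjoin k (Set.range x)
  let B := Algebra.adjoin k (insert y (Set.range x))
  have hyint : IsIntegral L y := hy.isIntegral
  -- Denominators of the minimal polynomial are cleared: `f` has coefficients in `k[x]`, and
  -- separability of `y` keeps `f'(y)` nonzero.
  obtain ⟨b0, hb0, hf⟩ := IsLocalization.integerNormalization_spec (nonZeroDivisors A0) (minpoly L y)
  set f := IsLocalization.integerNormalization (nonZeroDivisors A0) (minpoly L y) with hfdef
  have hb0' : algebraMap A0 L b0 ≠ 0 :=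
    IsFractionRing.to_map_ne_zero_of_mem_nonZeroDivisors hb0
  have hf' : f.map (algebraMap A0 L) = Polynomial.C (algebraMap A0 L b0) * minpoly L y := by
    rw [hf, Algebra.smul_def]; rfl
  have hA0B : A0 ≤ B := Algebra.adjoin_mono (Set.subset_insert _ _)
  have hyB : y ∈ B := Algebra.subset_adjoin (Set.mem_insert _ _)
  have hevB : ∀ q : Polynomial A0, q.eval₂ (algebraMap A0 Ω) y ∈ B := by
    intro q
    rw [Polynomial.eval₂_eq_sum_range]
    exact sum_mem fun i _ => mul_mem (hA0B (q.coeff i).2) (pow_mem hyB i)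
  have hev : ∀ q : Polynomial A0, q.eval₂ (algebraMap A0 Ω) y =
      Polynomial.aeval y (q.map (algebraMap A0 L)) := by
    intro q
    rw [Polynomial.aeval_map_algebraMap]
    rfl
  have hf0 : f.eval₂ (algebraMap A0 Ω) y = 0 := by
    rw [hev, hf', map_mul, minpoly.aeval, mul_zero]
  have hf1 : f.derivative.eval₂ (algebraMap A0 Ω) y ≠ 0 := by
    rw [hev, ← Polynomial.derivative_map, hf', Polynomial.derivative_C_mul, map_mul, Polynomial.aeval_C]
    refine mul_ne_zero ?_ (hy.aeval_derivative_ne_zero (minpoly.aeval _ _))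
    rwa [Ne, map_eq_zero]
  have hfrac : ∀ a : Ω, ∃ r ∈ B, ∃ s ∈ B, a ∈ T → r ≠ 0 ∧ s ≠ 0 ∧ a = r / s := by
    intro a
    by_cases ha : a ∈ T
    · obtain ⟨ha0, haE⟩ := hT a ha
      rw [← mem_restrictScalars k, adjoin_adjoin_left, mem_adjoin_iff_div, Set.union_singleton] at haE
      obtain ⟨r, hr, s, hs, rfl⟩ := haE
      obtain ⟨h1, h2⟩ := div_ne_zero_iff.mp ha0
      exact ⟨r, hr, s, hs, fun _ => ⟨h1, h2, rfl⟩⟩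
    · exact ⟨0, zero_mem _, 0, zero_mem _, fun h => absurd h ha⟩
  choose r hrB s hsB hrs using hfrac
  -- These elements must survive at the point: `f'(y)` for Hensel's lemma, the numerators and
  -- denominators for the units. Adjoining their inverses to `R` ensures this for every `ψ`.
  let W : Finset Ω := insert (f.derivative.eval₂ (algebraMap A0 Ω) y) (T.image r ∪ T.image s)
  let R := Algebra.adjoin k (insert y (Set.range x) ∪ (W.image (·⁻¹) : Set Ω))
  have hBR : B ≤ R := Algebra.adjoin_mono Set.subset_union_left
  refine ⟨R, Subalgebra.fg_def.mpr ⟨_, ((Set.finite_range x).insert y).union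
    (Finset.finite_toSet _), rfl⟩, ?_⟩
  intro κ _ _ ψ A _ _ _ _ res hensel H _ _ j hj z hz hz0
  have hunit : ∀ w ∈ W, w ≠ 0 → ∀ hw : w ∈ R, ψ ⟨w, hw⟩ ≠ 0 := by
    intro w hwW hw0 hw h
    have hw' : w⁻¹ ∈ R := Algebra.subset_adjoin (Or.inr (by simpa using hwW))
    have : (⟨w, hw⟩ : R) * ⟨w⁻¹, hw'⟩ = 1 := Subtype.ext (mul_inv_cancel₀ hw0)
    have := congrArg ψ this
    rw [map_mul, h, zero_mul, map_one] at this
    exact zero_ne_one this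
  have hxR : ∀ i, x i ∈ R := fun i => hBR (hA0B (Algebra.subset_adjoin ⟨i, rfl⟩))
  let c : ι → κ := fun i => ψ ⟨x i, hxR i⟩
  let w : ι → A := fun i => algebraMap κ A (c i) + z i
  have hw : AlgebraicIndependent k w := (hz.algebraMap_add c).restrictScalars
    (algebraMap k κ).injective
  let φ0 : A0 →ₐ[k] A := (MvPolynomial.aeval w).comp hx.aevalEquiv.symm.toAlgHom
  have hφ0 : Function.Injective φ0 := by
    rw [AlgHom.coe_comp]
    exact Function.Injective.comp hw hx.aevalEquiv.symm.injective
  have hφ0x : ∀ i (h : x i ∈ A0), φ0 ⟨x i, h⟩ = w i := by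
    intro i h
    have h1 : hx.aevalEquiv (MvPolynomial.X i) = ⟨x i, h⟩ := by
      apply Subtype.ext
      simp
    have h2 : hx.aevalEquiv.symm ⟨x i, h⟩ = MvPolynomial.X i := by
      rw [← h1, AlgEquiv.symm_apply_apply]
    change MvPolynomial.aeval w (hx.aevalEquiv.symm ⟨x i, h⟩) = w i
    rw [h2, MvPolynomial.aeval_X]
  have hresφ0 : ∀ (a : Ω) (ha : a ∈ A0), res (φ0 ⟨a, ha⟩) = ψ ⟨a, hBR (hA0B ha)⟩ := by
    intro a ha
    have : ((res.restrictScalars k).comp φ0) = ψ.comp (Subalgebra.inclusion (hA0B.trans hBR)) := by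
      refine AlgHom.ext_of_adjoin_eq_top (s := ((↑) : A0 → Ω) ⁻¹' (Set.range x))
        (Algebra.adjoin_adjoin_coe_preimage) ?_
      rintro ⟨a, ha⟩ ⟨i, hi⟩
      simp only at hi
      subst hi
      have h : res (φ0 ⟨x i, ha⟩) = c i := by
        rw [hφ0x]
        simp [w, hz0]
      exact h
    exact congrArg (fun φ => φ ⟨a, ha⟩) this
  have hyR : y ∈ R := hBR hyB
  have hevψ : ∀ q : Polynomial A0, ((q.map (φ0 : A0 →+* A)).map (res : A →+* κ)).eval (ψ ⟨y, hyR⟩) =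
      ψ ⟨q.eval₂ (algebraMap A0 Ω) y, hBR (hevB q)⟩ := by
    intro q
    have h1 : ((res : A →+* κ).comp (φ0 : A0 →+* A)) =
        (ψ : R →+* κ).comp (Subalgebra.inclusion (hA0B.trans hBR) : A0 →+* R) :=
      RingHom.ext fun a => hresφ0 a.1 a.2
    have h2 : (⟨q.eval₂ (algebraMap A0 Ω) y, hBR (hevB q)⟩ : R) =
        q.eval₂ (Subalgebra.inclusion (hA0B.trans hBR) : A0 →+* R) ⟨y, hyR⟩ :=
      Subtype.ext (Subalgebra.coe_eval₂_inclusion (hA0B.trans hBR) q ⟨y, hyR⟩).symm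
    rw [h2]
    exact Polynomial.eval_map_map_of_comp_eq h1 q ⟨y, hyR⟩
  -- Modulo the residue map, `φ0` agrees with `ψ`, so `ψ y` is a simple root of the reduced
  -- polynomial.
  obtain ⟨η, hη0, hηres⟩ := hensel (f.map (φ0 : A0 →+* A)) (ψ ⟨y, hyR⟩) (by
    rw [hevψ]
    have : (⟨f.eval₂ (algebraMap A0 Ω) y, hBR (hevB f)⟩ : R) = 0 := Subtype.ext hf0
    rw [this, map_zero]) (by
    rw [Polynomial.derivative_map, Polynomial.derivative_map, hevψ]
    exact hunit _ (Finset.mem_insert_self _ _) hf1 _)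
  have hinj : Function.Injective (j.comp φ0) := by
    rw [AlgHom.coe_comp]
    exact hj.comp hφ0
  let φ1 : L →+* H := IsFractionRing.lift (g := ((j.comp φ0 : A0 →ₐ[k] H) : A0 →+* H)) hinj
  have hφ1 : ∀ a : A0, φ1 (algebraMap A0 L a) = j (φ0 a) := IsFractionRing.lift_algebraMap hinj
  have hroot : (minpoly L y).eval₂ φ1 (j η) = 0 := by
    have h1 : (f.map (algebraMap A0 L)).eval₂ φ1 (j η) = 0 := by
      have : φ1.comp (algebraMap A0 L) = (j : A →+* H).comp (φ0 : A0 →+* A) :=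
        RingHom.ext hφ1
      rw [Polynomial.eval₂_map, this, ← Polynomial.eval₂_map, ← AlgHom.coe_toRingHom j,
        Polynomial.eval₂_at_apply, hη0, map_zero]
    rw [hf', Polynomial.eval₂_mul, Polynomial.eval₂_C] at h1
    exact (mul_eq_zero.mp h1).resolve_left fun h => hb0' ((map_eq_zero _).mp h)
  let Φ0 : L⟮y⟯ →+* H := (AdjoinRoot.lift φ1 (j η) hroot).comp
    ((adjoinRootEquivAdjoin L hyint).symm : L⟮y⟯ →+* AdjoinRoot (minpoly L y))
  have hΦL : ∀ l : L, Φ0 (algebraMap L L⟮y⟯ l) = φ1 l := by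
    intro l
    have : (adjoinRootEquivAdjoin L hyint).symm (algebraMap L L⟮y⟯ l) = algebraMap L _ l :=
      AlgEquiv.commutes _ _
    simp only [Φ0, RingHom.comp_apply]
    change AdjoinRoot.lift φ1 (j η) hroot ((adjoinRootEquivAdjoin L hyint).symm _) = _
    rw [this]
    exact AdjoinRoot.lift_of hroot
  have hΦy : Φ0 (AdjoinSimple.gen L y) = j η := by
    simp only [Φ0, RingHom.comp_apply]
    change AdjoinRoot.lift φ1 (j η) hroot ((adjoinRootEquivAdjoin L hyint).symm _) = _
    rw [adjoinRootEquivAdjoin_symm_apply_gen]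
    exact AdjoinRoot.lift_root hroot
  have hΦk : ∀ a : k, Φ0 (algebraMap k _ a) = algebraMap k H a := by
    intro a
    have h1 : (algebraMap k L⟮y⟯ a) = algebraMap L L⟮y⟯ (algebraMap A0 L (algebraMap k A0 a)) := rfl
    rw [h1, hΦL, hφ1, AlgHom.commutes, AlgHom.commutes]
  let Φ : (L⟮y⟯).restrictScalars k →ₐ[k] H := { Φ0 with commutes' := hΦk }
  have hΦx : ∀ (i : ι) (a : L⟮y⟯), (a : Ω) = x i → Φ0 a = j (w i) := by
    intro i a ha
    have h : x i ∈ A0 := Algebra.subset_adjoin ⟨i, rfl⟩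
    have : a = algebraMap L L⟮y⟯ (algebraMap A0 L ⟨x i, h⟩) := Subtype.ext ha
    rw [this, hΦL, hφ1, hφ0x]
  -- On `k[x, y]` the embedding takes values in `A` and reduces to `ψ`; both properties pass from
  -- generators to sums and products.
  have hB : ∀ b (hb : b ∈ B), ∃ (hE : b ∈ L⟮y⟯) (b' : A), Φ0 ⟨b, hE⟩ = j b' ∧
      res b' = ψ ⟨b, hBR hb⟩ := by
    intro b hb
    induction hb using Algebra.adjoin_induction with
    | mem b hb =>
      rcases hb with rfl | ⟨i, rfl⟩
      · exact ⟨mem_adjoin_simple_self L b, η, hΦy, hηres⟩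
      · refine ⟨(L⟮y⟯).algebraMap_mem ⟨x i, subset_adjoin k _ ⟨i, rfl⟩⟩, w i, hΦx i _ rfl, ?_⟩
        simp [w, hz0, c]
    | algebraMap a =>
      refine ⟨(L⟮y⟯).algebraMap_mem (algebraMap k L a), algebraMap k A a,
        (hΦk a).trans (AlgHom.commutes j a).symm, ?_⟩
      have h1 : res (algebraMap k A a) = algebraMap k κ a := by
        rw [IsScalarTower.algebraMap_apply k κ A, AlgHom.commutes]; rfl
      rw [h1, ← AlgHom.commutes ψ]
      rfl
    | add a b ha hb iha ihb =>
      obtain ⟨h1, a', ha', ha''⟩ := iha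
      obtain ⟨h2, b', hb', hb''⟩ := ihb
      refine ⟨add_mem h1 h2, a' + b', ?_, ?_⟩
      · rw [map_add, ← ha', ← hb', ← map_add]; rfl
      · rw [map_add, ha'', hb'', ← map_add]; rfl
    | mul a b ha hb iha ihb =>
      obtain ⟨h1, a', ha', ha''⟩ := iha
      obtain ⟨h2, b', hb', hb''⟩ := ihb
      refine ⟨mul_mem h1 h2, a' * b', ?_, ?_⟩
      · rw [map_mul, ← ha', ← hb', ← map_mul]; rfl
      · rw [map_mul, ha'', hb'', ← map_mul]; rfl
  refine ⟨Φ, c, ?_, hΦx⟩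
  rintro ⟨a, haE⟩ haT
  simp only at haT
  obtain ⟨hr0, hs0, hars⟩ := hrs a haT
  obtain ⟨hrE, u, hu, hures⟩ := hB (r a) (hrB a)
  obtain ⟨hsE, v, hv, hvres⟩ := hB (s a) (hsB a)
  refine ⟨u, v, ?_, ?_, ?_⟩
  · rw [hures]
    exact hunit _ (Finset.mem_insert_of_mem (Finset.mem_union_left _
      (Finset.mem_image_of_mem _ haT))) hr0 _
  · rw [hvres]
    exact hunit _ (Finset.mem_insert_of_mem (Finset.mem_union_right _
      (Finset.mem_image_of_mem _ haT))) hs0 _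
  · rw [← hu, ← hv, ← map_div₀]
    exact congrArg Φ0 (Subtype.ext hars)

end HenselianEmbedding

/-! ### Positive bases of `Γ` and embeddings into Hahn series over `Γ`. -/

section OrderedLattices

variable {Γ : Type*} [AddCommGroup Γ] [LinearOrder Γ] [IsOrderedAddMonoid Γ]

/-- In a total order each basis vector or its negative is positive, and changing signs preserves a
basis. -/
theorem exists_pos_basis {r : ℕ} (e : Γ ≃+ (Fin r → ℤ)) :
    ∃ g : Fin r → Γ, (∀ i, 0 < g i) ∧
      (Function.Injective fun n : Fin r →₀ ℕ => ∑ i, n i • g i) ∧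
      AddSubgroup.closure (Set.range g) = ⊤ := by
  classical
  let b : Fin r → Γ := fun i => e.symm (Pi.single i 1)
  have hb : ∀ i, b i ≠ 0 := fun i h => by
    have := congrFun (congrArg e h) i
    simp [b] at this
  have heb : ∀ i, e (b i) = Pi.single i 1 := fun i => e.apply_symm_apply _
  have hε : ∀ i, ∃ ε : ℤ, ε * ε = 1 ∧ 0 < ε • b i := fun i => by
    rcases lt_or_gt_of_ne (hb i) with h | h
    · exact ⟨-1, by norm_num, by simpa using h⟩
    · exact ⟨1, by norm_num, by simpa using h⟩
  choose ε hε hpos using hε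
  refine ⟨fun i => ε i • b i, hpos, ?_, ?_⟩
  · have key : ∀ (n : Fin r →₀ ℕ) (j : Fin r), e (∑ i, n i • ε i • b i) j = n j * ε j := by
      intro n j
      simp [map_sum, map_nsmul, map_zsmul, heb, Finset.sum_apply, Pi.single_apply]
    intro n n' h
    ext j
    have h1 := congrFun (congrArg e h) j
    simp only [key] at h1
    have h2 : ε j ≠ 0 := fun h0 => by simpa [h0] using hε j
    exact_mod_cast mul_right_cancel₀ h2 h1
  · rw [eq_top_iff]
    intro a _
    have ha : a = ∑ i, (e a i * ε i) • ε i • b i := by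
      apply e.injective
      ext j
      simp [map_sum, map_zsmul, heb, Finset.sum_apply, Pi.single_apply, mul_assoc, hε]
    rw [ha]
    exact sum_mem fun i _ => AddSubgroup.zsmul_mem _ (AddSubgroup.subset_closure (Set.mem_range_self i)) _

omit [IsOrderedAddMonoid Γ] in
theorem HahnSeries.orderTop_eq_zero_of_coeff {κ : Type*} [Field κ] {x : HahnSeries Γ κ}
    (h : ∀ g < 0, x.coeff g = 0) (h0 : x.coeff 0 ≠ 0) : x.orderTop = 0 :=
  le_antisymm (HahnSeries.orderTop_le_of_coeff_ne_zero h0)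
    (HahnSeries.le_orderTop_iff_forall.mpr fun i hi => h i (by exact_mod_cast hi))

-- The henselian ring is the ring of series on `S`, mapped into series on `Γ` along `f`. Elements
-- with nonzero constant coefficient get value `0`, since no exponent is negative.
open IntermediateField in
theorem exists_subalgebra_forall_exists_algHom_hahnSeries {S : Type*} [AddCommMonoid S]
    [LinearOrder S] [IsOrderedCancelAddMonoid S] [WellFoundedLT S] (hS : ∀ s : S, 0 ≤ s)
    (f : S →+ Γ) (hf : Function.Injective f) (hfle : ∀ s t, f s ≤ f t ↔ s ≤ t)
    {r : ℕ} (g' : Fin r → S) (h0 : ∀ i, g' i ≠ 0)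
    (hinj : Function.Injective fun n : Fin r →₀ ℕ => ∑ i, n i • g' i)
    (c0 : S) (hcof : ∀ s : S, ∃ n : ℕ, s < n • c0)
    {k : Type*} {Ω : Type*} [Field k] [Field Ω] [Algebra k Ω] {m : ℕ} (x : Fin (r + m) → Ω)
    (hx : AlgebraicIndependent k x) (y : Ω) (hy : IsSeparable (adjoin k (Set.range x)) y)
    (T : Finset Ω) (hT : ∀ a ∈ T, a ≠ 0 ∧ a ∈ (adjoin k (Set.range x))⟮y⟯) :
    ∃ R : Subalgebra k Ω, R.FG ∧
      ∀ {κ : Type*} [Field κ] [Algebra k κ] (_ : R →ₐ[k] κ),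
        ∃ (Φ : ((adjoin k (Set.range x))⟮y⟯).restrictScalars k →ₐ[k] HahnSeries Γ κ),
          (∀ a : ((adjoin k (Set.range x))⟮y⟯).restrictScalars k, (a : Ω) ∈ T →
            HahnSeries.addVal Γ κ (Φ a) = 0) ∧
          ∀ i : Fin r, ∃ c : κ, ∀ a : ((adjoin k (Set.range x))⟮y⟯).restrictScalars k,
            (a : Ω) = x (Fin.castAdd m i) →
            Φ a = HahnSeries.C c + HahnSeries.single (f (g' i)) 1 := by
  obtain ⟨R, hR, H⟩ := exists_subalgebra_forall_exists_algHom x hx y hy T hT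
  refine ⟨R, hR, ?_⟩
  intro κ _ _ ψ
  obtain ⟨z, hz, hz0, hzg⟩ := HahnSeries.exists_algebraicIndependent_extension (k := κ) _ hcof hS _
    (HahnSeries.algebraicIndependent_single g' hinj)
    (fun i => HahnSeries.coeff_single_of_ne (h0 i).symm) m
  let j : HahnSeries S κ →ₐ[k] HahnSeries Γ κ :=
    HahnSeries.embDomainAlgHom f hf hfle
  have hj : Function.Injective j := HahnSeries.embDomain_injective
  have hjcoeff : ∀ u (s : S), (j u).coeff (f s) = u.coeff s := fun u s =>
    HahnSeries.embDomain_coeff (f := ⟨⟨f, hf⟩, hfle _ _⟩)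
  have hjneg : ∀ u, ∀ s < 0, (j u).coeff s = 0 := fun u s hs =>
    HahnSeries.embDomain_of_notMem_range fun ⟨t, ht⟩ => (hS t).not_gt (by
      rw [← not_le, ← hfle, map_zero, not_le]; exact (show f t = s from ht) ▸ hs)
  have hval : ∀ u : HahnSeries S κ, u.coeff 0 ≠ 0 → HahnSeries.addVal Γ κ (j u) = 0 := fun u hu =>
    HahnSeries.orderTop_eq_zero_of_coeff (hjneg u) (by
      have := hjcoeff u 0
      rw [map_zero] at this
      rwa [this])
  obtain ⟨Φ, c, hΦT, hΦx⟩ := H ψ (HahnSeries.residueHom κ hS)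
    (fun p a h0 h1 => HahnSeries.exists_eval_eq_zero hS p a h0 h1) j hj z hz hz0
  refine ⟨Φ, ?_, ?_⟩
  · intro a ha
    obtain ⟨u, v, hu, hv, hauv⟩ := hΦT a ha
    have hv0 : j v ≠ 0 := fun h => by
      have := hval v hv
      rw [h, AddValuation.map_zero] at this
      exact WithTop.top_ne_zero this
    have h1 : Φ a * j v = j u := by rw [hauv, div_mul_cancel₀ _ hv0]
    have h2 := congrArg (HahnSeries.addVal Γ κ) h1
    rwa [AddValuation.map_mul, hval u hu, hval v hv, add_zero] at h2
  · intro i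
    refine ⟨c (Fin.castAdd m i), fun a ha => ?_⟩
    rw [hΦx _ a ha, map_add, hzg]
    refine congrArg₂ (· + ·) ?_ ?_
    · exact HahnSeries.embDomain_single.trans (congrArg (fun t => HahnSeries.single t (c _)) f.map_zero)
    · exact HahnSeries.embDomain_single

open IntermediateField in
/-- Embeddings of separably generated function fields into fields of Hahn series. -/
theorem exists_pos_generators_forall_exists_algHom_hahnSeries {r : ℕ} (hr : 1 ≤ r)
    (e : Γ ≃+ (Fin r → ℤ)) :
    ∃ g : Fin r → Γ, (∀ i, 0 < g i) ∧ AddSubgroup.closure (Set.range g) = ⊤ ∧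
    ∀ {k : Type*} {Ω : Type*} [Field k] [Field Ω] [Algebra k Ω] {m : ℕ} (x : Fin (r + m) → Ω)
      (_ : AlgebraicIndependent k x) (y : Ω) (_ : IsSeparable (adjoin k (Set.range x)) y)
      (T : Finset Ω) (_ : ∀ a ∈ T, a ≠ 0 ∧ a ∈ (adjoin k (Set.range x))⟮y⟯),
      ∃ R : Subalgebra k Ω, R.FG ∧
      ∀ {κ : Type*} [Field κ] [Algebra k κ] (_ : R →ₐ[k] κ),
        ∃ (Φ : ((adjoin k (Set.range x))⟮y⟯).restrictScalars k →ₐ[k] HahnSeries Γ κ),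
          (∀ a : ((adjoin k (Set.range x))⟮y⟯).restrictScalars k, (a : Ω) ∈ T →
            HahnSeries.addVal Γ κ (Φ a) = 0) ∧
          ∀ i : Fin r, ∃ c : κ, ∀ a : ((adjoin k (Set.range x))⟮y⟯).restrictScalars k,
            (a : Ω) = x (Fin.castAdd m i) →
            Φ a = HahnSeries.C c + HahnSeries.single (g i) 1 := by
  obtain ⟨g, hpos, hinj, htop⟩ := exists_pos_basis e
  refine ⟨g, hpos, htop, ?_⟩
  intro k Ω _ _ _ m x hx y hy T hT
  let S : AddSubmonoid Γ := AddSubmonoid.closure (Set.range g)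
  have hS : ∀ s : S, 0 ≤ s := by
    have : S ≤ AddSubmonoid.nonneg Γ := by
      rw [AddSubmonoid.closure_le]
      rintro _ ⟨i, rfl⟩
      exact (hpos i).le
    exact fun s => this s.2
  -- A monoid generated by finitely many nonnegative elements is partially well ordered, so no
  -- archimedean assumption on `Γ` is needed.
  have hwf : WellFoundedLT S := by
    have : (S : Set Γ).IsPWO := by
      refine Set.IsPWO.addSubmonoid_closure ?_ (Set.finite_range g).isPWO
      rintro _ ⟨i, rfl⟩
      exact (hpos i).le
    exact ⟨this.isWF⟩
  let g' : Fin r → S := fun i => ⟨g i, AddSubmonoid.subset_closure ⟨i, rfl⟩⟩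
  -- The sum of the generators is cofinal in `S` even when no single generator is; `1 ≤ r` makes it
  -- positive.
  have hcof : ∀ s : S, ∃ n : ℕ, s < n • ∑ i, g' i := by
    have h0 : 0 < ∑ i, g i := Finset.sum_pos (fun i _ => hpos i) ⟨(⟨0, hr⟩ : Fin r), Finset.mem_univ _⟩
    have : ∀ s ∈ S, ∃ n : ℕ, s < n • ∑ i, g i := by
      intro s hs
      induction hs using AddSubmonoid.closure_induction with
      | mem s hs =>
        obtain ⟨i, rfl⟩ := hs
        refine ⟨2, ?_⟩
        have : g i ≤ ∑ i, g i := Finset.single_le_sum (fun i _ => (hpos i).le) (Finset.mem_univ i)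
        rw [two_nsmul]
        exact this.trans_lt (lt_add_of_pos_left _ h0)
      | zero => exact ⟨1, by simpa using h0⟩
      | add a b _ _ ha hb =>
        obtain ⟨n, hn⟩ := ha
        obtain ⟨n', hn'⟩ := hb
        exact ⟨n + n', by rw [add_nsmul]; exact add_lt_add hn hn'⟩
    rintro ⟨s, hs⟩
    obtain ⟨n, hn⟩ := this s hs
    refine ⟨n, ?_⟩
    rw [← Subtype.coe_lt_coe]
    simpa [g'] using hn
  have hinj' : Function.Injective fun n : Fin r →₀ ℕ => ∑ i, n i • g' i := by
    intro n n' h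
    apply hinj
    simpa [g'] using congrArg (Subtype.val) h
  obtain ⟨R, hR, H⟩ := exists_subalgebra_forall_exists_algHom_hahnSeries hS S.subtype
    Subtype.val_injective (fun _ _ => Iff.rfl) g' (fun i h => (hpos i).ne' (congrArg Subtype.val h))
    hinj' _ hcof x hx y hy T hT
  exact ⟨R, hR, fun ψ => H ψ⟩

end OrderedLattices

/-! ### Places induced by embeddings into Hahn series. -/

section HahnPlaces

variable {Γ : Type w} [AddCommGroup Γ] [LinearOrder Γ] [IsOrderedAddMonoid Γ]

theorem HahnSeries.coeff_mul_zero_of_nonneg {κ : Type*} [Field κ] {x y : HahnSeries Γ κ}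
    (hx : 0 ≤ x.orderTop) (hy : 0 ≤ y.orderTop) : (x * y).coeff 0 = x.coeff 0 * y.coeff 0 := by
  have hneg : ∀ {x : HahnSeries Γ κ}, 0 ≤ x.orderTop → ∀ g, x.coeff g ≠ 0 → 0 ≤ g := fun hx g hg => by
    by_contra h
    exact hg (coeff_eq_zero_of_lt_orderTop
      (lt_of_lt_of_le (by exact_mod_cast not_le.mp h) hx))
  rw [coeff_mul]
  refine Finset.sum_eq_single (0, 0) ?_ ?_
  · rintro ⟨i, j⟩ hij hne
    rw [Finset.mem_antidiagonal] at hij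
    obtain ⟨hi, hj, hij⟩ := hij
    have hi' := hneg hx i hi
    have hj' := hneg hy j hj
    exact absurd (Prod.ext ((add_eq_zero_iff_of_nonneg hi' hj').mp hij).1
      ((add_eq_zero_iff_of_nonneg hi' hj').mp hij).2) hne
  · intro h
    by_contra h0
    refine h ?_
    rw [Finset.mem_antidiagonal]
    exact ⟨left_ne_zero_of_mul h0, right_ne_zero_of_mul h0, add_zero 0⟩

variable {F : Type v} [Field F] {κ : Type v} [Field κ]

open Classical in
/-- The place of a field induced by an embedding into a field of Hahn series. -/
noncomputable def FieldPlace.ofHahnSeries (Φ : F →+* HahnSeries Γ κ) : FieldPlace F κ where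
  toFun a := if 0 ≤ (Φ a).orderTop then (((Φ a).coeff 0 : κ) : OnePoint κ) else OnePoint.infty
  map_one := by
    simp [HahnSeries.coeff_one]
  map_add a b x y ha hb := by
    split_ifs at ha with h1
    split_ifs at hb with h2
    · rw [if_pos, RingHom.map_add, HahnSeries.coeff_add, OnePoint.coe_injective ha,
        OnePoint.coe_injective hb]
      rw [RingHom.map_add]
      exact (le_min h1 h2).trans HahnSeries.min_orderTop_le_orderTop_add
    · exact absurd hb (OnePoint.infty_ne_coe _)
    · exact absurd ha (OnePoint.infty_ne_coe _)
  map_mul a b x y ha hb := by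
    split_ifs at ha with h1
    split_ifs at hb with h2
    · rw [if_pos, RingHom.map_mul, HahnSeries.coeff_mul_zero_of_nonneg h1 h2, OnePoint.coe_injective ha,
        OnePoint.coe_injective hb]
      rw [RingHom.map_mul, HahnSeries.orderTop_mul]
      exact add_nonneg h1 h2
    · exact absurd hb (OnePoint.infty_ne_coe _)
    · exact absurd ha (OnePoint.infty_ne_coe _)
  map_add_infty a b ha hb := by
    split_ifs at ha with h1
    · exact absurd ha (OnePoint.coe_ne_infty _)
    · split_ifs at hb with h2
      · refine if_neg fun h => h1 ?_
        have h3 := (le_min h h2).trans HahnSeries.min_orderTop_le_orderTop_sub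
        rwa [RingHom.map_add, add_sub_cancel_right] at h3
      · exact absurd rfl hb
  map_mul_infty a b ha hb := by
    split_ifs at ha with h1
    · exact absurd ha (OnePoint.coe_ne_infty _)
    · refine if_neg fun h => h1 ?_
      have hb0 : (Φ b).orderTop ≤ 0 := by
        split_ifs at hb with h2
        · exact HahnSeries.orderTop_le_of_coeff_ne_zero fun h => hb (by rw [h])
        · exact (not_le.mp h2).le
      rw [RingHom.map_mul, HahnSeries.orderTop_mul] at h
      exact h.trans (add_le_of_nonpos_right hb0)

variable {K : Type u} [Field K] [Algebra K F] [Algebra K κ]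

/-- The place over `K` induced by a `K`-embedding into a field of Hahn series. -/
noncomputable def PlaceOver.ofHahnSeries (Φ : F →ₐ[K] HahnSeries Γ κ) : PlaceOver K F where
  codomain := κ
  place := FieldPlace.ofHahnSeries (Φ : F →+* HahnSeries Γ κ)
  trivial_on c := by
    have : (Φ : F →+* HahnSeries Γ κ) (algebraMap K F c) = HahnSeries.C (algebraMap K κ c) :=
      Φ.commutes c
    simp only [FieldPlace.ofHahnSeries, this]
    rw [if_pos]
    · simp [HahnSeries.C]
    · exact HahnSeries.orderTop_single_le

theorem PlaceOver.ofHahnSeries_place_ne_infty (Φ : F →ₐ[K] HahnSeries Γ κ) (a : F) :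
    (PlaceOver.ofHahnSeries Φ).place a ≠ OnePoint.infty ↔ 0 ≤ HahnSeries.addVal Γ κ (Φ a) := by
  change (if 0 ≤ (Φ a).orderTop then (((Φ a).coeff 0 : κ) : OnePoint κ) else OnePoint.infty) ≠ _ ↔
    0 ≤ (Φ a).orderTop
  split_ifs with h
  · exact iff_of_true (OnePoint.coe_ne_infty _) h
  · exact iff_of_false (fun h' => h' rfl) h

theorem PlaceOver.ofHahnSeries_place_eq_zero (Φ : F →ₐ[K] HahnSeries Γ κ) (a : F) :
    (PlaceOver.ofHahnSeries Φ).place a = ((0 : κ) : OnePoint κ) ↔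
      0 < HahnSeries.addVal Γ κ (Φ a) := by
  change (if 0 ≤ (Φ a).orderTop then (((Φ a).coeff 0 : κ) : OnePoint κ) else OnePoint.infty) = _ ↔
    0 < (Φ a).orderTop
  split_ifs with h
  · constructor
    · intro h0
      refine lt_of_le_of_ne h fun h1 => HahnSeries.coeff_orderTop_ne h1.symm ?_
      exact OnePoint.coe_injective h0
    · intro h0
      rw [HahnSeries.coeff_eq_zero_of_lt_orderTop h0]
  · simpa using (not_le.mp h).le

theorem PlaceOver.isAssociatedValuation_ofHahnSeries (Φ : F →ₐ[K] HahnSeries Γ κ) :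
    (PlaceOver.ofHahnSeries Φ).IsAssociatedValuation
      ((HahnSeries.addVal Γ κ).comap (Φ : F →+* HahnSeries Γ κ)) := fun a =>
  (PlaceOver.ofHahnSeries_place_ne_infty Φ a).symm

end HahnPlaces

/-! ### Infinitely many inequivalent places by avoidance. -/

section InfinitelyMany

variable {K : Type u} {F : Type v} [Field K] [Field F] [Algebra K F]

theorem PlaceOver.not_equivalent_of_place_eq_zero {p q : PlaceOver K F} {b : F}
    (hp : p.place b = ((0 : p.codomain) : OnePoint p.codomain))
    (hq : q.place b ≠ ((0 : q.codomain) : OnePoint q.codomain)) : ¬ p.Equivalent q := by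
  rintro ⟨σ, hσ, -⟩
  exact hq (by simpa using hσ b 0 hp)

/-- An equivalence sends infinity to infinity and is injective on finite values, so it can produce
the value zero only from zero. -/
theorem PlaceOver.not_equivalent_of_place_eq_zero' {p q : PlaceOver K F} {b : F}
    (hp : p.place b = ((0 : p.codomain) : OnePoint p.codomain))
    (hq : q.place b ≠ ((0 : q.codomain) : OnePoint q.codomain)) : ¬ q.Equivalent p := by
  rintro ⟨σ, hσ, hinf⟩
  cases hb : q.place b with
  | infty =>
    have := hinf b hb
    rw [hp] at this
    exact OnePoint.coe_ne_infty _ this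
  | coe y =>
    let y' : q.residueField := ⟨y, b, hb⟩
    have h1 := hσ b y' hb
    rw [hp] at h1
    have h2 : (σ y' : p.codomain) = 0 := (OnePoint.coe_injective h1).symm
    have h3 : y' = 0 := (map_eq_zero σ).mp (Subtype.ext h2)
    refine hq ?_
    rw [hb, show y = 0 from congrArg Subtype.val h3]

/-- If places with a property can be chosen to be units at arbitrary finite sets of nonzero
elements, then there are infinitely many of them. -/
theorem PlaceOver.exists_seq_pairwise_not_equivalent (P : PlaceOver K F → Prop)
    (hP : ∀ p, P p → ∃ b : F, b ≠ 0 ∧ p.place b = ((0 : p.codomain) : OnePoint p.codomain))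
    (h : ∀ T : Finset F, (∀ a ∈ T, a ≠ 0) → ∃ p, P p ∧ ∀ a ∈ T,
      p.place a ≠ ((0 : p.codomain) : OnePoint p.codomain) ∧ p.place a ≠ OnePoint.infty)
    {m : ℕ} (a : Fin m → F) (ha : ∀ i, a i ≠ 0) :
    ∃ lam : ℕ → PlaceOver K F, Pairwise (fun i j => ¬ (lam i).Equivalent (lam j)) ∧
      ∀ n, P (lam n) ∧ ∀ i,
        (lam n).place (a i) ≠ ((0 : (lam n).codomain) : OnePoint (lam n).codomain) ∧
          (lam n).place (a i) ≠ OnePoint.infty := by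
  classical
  choose! b hb0 hb using hP
  obtain ⟨lam, h1, h2⟩ := exists_seq_of_forall_finset_exists
    (fun p : PlaceOver K F => P p ∧ ∀ i, p.place (a i) ≠ ((0 : p.codomain) : OnePoint p.codomain) ∧
      p.place (a i) ≠ OnePoint.infty)
    (fun p q => ¬ p.Equivalent q ∧ ¬ q.Equivalent p) (fun s hs => by
      -- Besides the given elements, the new place must be a unit at every witness `b q` killed by
      -- an earlier place `q`.
      obtain ⟨p, hp, hpT⟩ := h (Finset.univ.image a ∪ s.image b) (by
        intro c hc
        rcases Finset.mem_union.mp hc with hc | hc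
        · obtain ⟨i, -, rfl⟩ := Finset.mem_image.mp hc
          exact ha i
        · obtain ⟨q, hq, rfl⟩ := Finset.mem_image.mp hc
          exact hb0 q (hs q hq).1)
      refine ⟨p, ⟨hp, fun i => hpT _ (Finset.mem_union_left _
        (Finset.mem_image_of_mem _ (Finset.mem_univ _)))⟩, fun q hq => ?_⟩
      have h3 := (hpT (b q) (Finset.mem_union_right _ (Finset.mem_image_of_mem _ hq))).1
      have h4 := hb q (hs q hq).1
      exact ⟨not_equivalent_of_place_eq_zero h4 h3, not_equivalent_of_place_eq_zero' h4 h3⟩)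
  refine ⟨lam, fun i j hij => ?_, h1⟩
  rcases hij.lt_or_gt with h | h
  · exact (h2 i j h).1
  · exact (h2 j i h).2

end InfinitelyMany

/-! ### Existential closedness: rational points and separable generation. -/

section ExistentiallyClosed

open FirstOrder FirstOrder.Language

/-- The conjunction of finitely many polynomial equations. -/
noncomputable def FirstOrder.Ring.equationsFormula {α : Type*} {n : ℕ} :
    List (FreeCommRing (α ⊕ Fin n)) → Language.ring.BoundedFormula α n
  | [] => ⊤
  | p :: l => (FirstOrder.Ring.termOfFreeCommRing p).bdEqual
      (FirstOrder.Ring.termOfFreeCommRing 0) ⊓ equationsFormula l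

theorem FirstOrder.Ring.isQF_equationsFormula {α : Type*} {n : ℕ}
    (l : List (FreeCommRing (α ⊕ Fin n))) : (equationsFormula l).IsQF := by
  induction l with
  | nil => exact BoundedFormula.IsQF.top
  | cons p l ih => exact BoundedFormula.IsQF.inf (BoundedFormula.IsAtomic.equal _ _).isQF ih

theorem FirstOrder.Ring.realize_equationsFormula {α : Type*} {n : ℕ} {M : Type*} [CommRing M]
    [CompatibleRing M] (l : List (FreeCommRing (α ⊕ Fin n))) (v : α → M) (x : Fin n → M) :
    (equationsFormula l).Realize v x ↔ ∀ p ∈ l, FreeCommRing.lift (Sum.elim v x) p = 0 := by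
  induction l with
  | nil => simp [equationsFormula]
  | cons p l ih => simp [equationsFormula, ih]

theorem FirstOrder.Language.BoundedFormula.IsExistential.exs {L : Language} {α : Type*} {n : ℕ}
    {φ : L.BoundedFormula α n} (h : φ.IsExistential) :
    BoundedFormula.IsExistential φ.exs := by
  induction n with
  | zero => exact h
  | succ n ih => exact ih h.ex

variable {K : Type u} {F : Type v} [Field K] [Field F] [Algebra K F]

theorem IsExistentiallyClosedIn.exists_eval_eq_zero (h : IsExistentiallyClosedIn K F) {n : ℕ}
    (s : Finset (MvPolynomial (Fin n) K)) (x : Fin n → F)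
    (hx : ∀ p ∈ s, MvPolynomial.aeval x p = 0) :
    ∃ y : Fin n → K, ∀ p ∈ s, MvPolynomial.aeval y p = 0 := by
  let _ := FirstOrder.Ring.compatibleRingOfRing K
  let _ := FirstOrder.Ring.compatibleRingOfRing F
  -- Terms of the ring language have integer coefficients; the elements of `K` enter as free
  -- variables. Surjectivity of `π` writes every polynomial over `K` as such a term.
  let π : FreeCommRing (K ⊕ Fin n) →+* MvPolynomial (Fin n) K :=
    FreeCommRing.lift (Sum.elim MvPolynomial.C MvPolynomial.X)
  have hπ : Function.Surjective π := by
    intro p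
    induction p using MvPolynomial.induction_on with
    | C a => exact ⟨FreeCommRing.of (Sum.inl a), by simp [π]⟩
    | add p q hp hq =>
      obtain ⟨a, rfl⟩ := hp
      obtain ⟨b, rfl⟩ := hq
      exact ⟨a + b, map_add _ _ _⟩
    | mul_X p i hp =>
      obtain ⟨a, rfl⟩ := hp
      exact ⟨a * FreeCommRing.of (Sum.inr i), by simp [π]⟩
  choose σ hσ using hπ
  have hF : ∀ p, FreeCommRing.lift (Sum.elim (algebraMap K F : K → F) x) (σ p) =
      MvPolynomial.aeval x p := by
    intro p
    have : FreeCommRing.lift (Sum.elim (algebraMap K F : K → F) x) =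
        ((MvPolynomial.aeval x : MvPolynomial (Fin n) K →ₐ[K] F) : _ →+* F).comp π := by
      apply FreeCommRing.hom_ext
      rintro (a | i) <;> simp [π]
    rw [this, RingHom.comp_apply, hσ]
    rfl
  have hK : ∀ (y : Fin n → K) p, FreeCommRing.lift (Sum.elim (fun c : K => c) y) (σ p) =
      MvPolynomial.aeval y p := by
    intro y p
    have : FreeCommRing.lift (Sum.elim (fun c : K => c) y) =
        ((MvPolynomial.aeval y : MvPolynomial (Fin n) K →ₐ[K] K) : _ →+* K).comp π := by
      apply FreeCommRing.hom_ext
      rintro (a | i) <;> simp [π]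
    rw [this, RingHom.comp_apply, hσ]
    rfl
  have key := h (FirstOrder.Ring.equationsFormula (s.toList.map σ)).exs
    (FirstOrder.Ring.isQF_equationsFormula _).isExistential.exs
    (BoundedFormula.realize_exs.mpr ⟨x, by
      rw [FirstOrder.Ring.realize_equationsFormula]
      intro q hq
      obtain ⟨p, hp, rfl⟩ := List.mem_map.mp hq
      rw [hF]
      exact hx p (Finset.mem_toList.mp hp)⟩)
  obtain ⟨y, hy⟩ := BoundedFormula.realize_exs.mp key
  rw [FirstOrder.Ring.realize_equationsFormula] at hy
  refine ⟨y, fun p hp => ?_⟩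
  rw [← hK]
  exact hy _ (List.mem_map.mpr ⟨p, Finset.mem_toList.mpr hp, rfl⟩)

/-- By Hilbert's basis theorem `R` has finitely many relations. Its generators solve them in `F`, so
they have a solution in `K`. -/
theorem IsExistentiallyClosedIn.nonempty_algHom (h : IsExistentiallyClosedIn K F)
    (R : Subalgebra K F) (hR : R.FG) : Nonempty (R →ₐ[K] K) := by
  have : Algebra.FiniteType K R := R.fg_iff_finiteType.mp hR
  obtain ⟨n, f, hf⟩ := Algebra.FiniteType.iff_quotient_mvPolynomial''.mp this
  obtain ⟨s, hs⟩ := (isNoetherianRing_iff_ideal_fg _).mp inferInstance (RingHom.ker f)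
  obtain ⟨y, hy⟩ := h.exists_eval_eq_zero s (fun i => (f (MvPolynomial.X i) : F)) (by
    intro p hp
    have h1 : f p = 0 := by
      have : p ∈ RingHom.ker f := hs ▸ Ideal.subset_span hp
      exact this
    have h2 : MvPolynomial.aeval (fun i => (f (MvPolynomial.X i) : F)) = R.val.comp f := by
      ext i
      simp
    rw [h2, AlgHom.comp_apply, h1, map_zero])
  have hker : ∀ p ∈ RingHom.ker f, MvPolynomial.aeval y p = 0 := by
    intro p hp
    have : RingHom.ker f ≤ RingHom.ker (MvPolynomial.aeval y : MvPolynomial (Fin n) K →ₐ[K] K) := by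
      rw [← hs, Ideal.span_le]
      exact hy
    exact this hp
  exact ⟨(Ideal.Quotient.liftₐ _ _ hker).comp
    (Ideal.quotientKerAlgEquivOfSurjective hf).symm.toAlgHom⟩

/-- MacLane's condition. A `K`-point of `K[a, (a 0)⁻¹]` gives values `y` in `K` satisfying the same
relation with `y 0 ≠ 0`. Solving for `c 0` turns the relation into a shorter one for the independent
elements `a i - (y i / y 0) a 0`, because `p`-th powers are additive. -/
theorem IsExistentiallyClosedIn.eq_zero_of_sum_smul_pow_eq_zero (h : IsExistentiallyClosedIn K F) (p : ℕ)
    [ExpChar K p] {n : ℕ} (a : Fin n → F) (ha : LinearIndependent K a)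
    (c : Fin n → K) (hc : ∑ i, c i • a i ^ p = 0) : c = 0 := by
  have : ExpChar F p := expChar_of_injective_algebraMap (algebraMap K F).injective p
  induction n with
  | zero => exact Subsingleton.elim _ _
  | succ n ih =>
    have ha0 : a 0 ≠ 0 := ha.ne_zero 0
    let R := Algebra.adjoin K (insert (a 0)⁻¹ (Set.range a))
    obtain ⟨ψ⟩ := h.nonempty_algHom R (Subalgebra.fg_def.mpr ⟨_, (Set.finite_range a).insert _, rfl⟩)
    have haR : ∀ i, a i ∈ R := fun i => Algebra.subset_adjoin (Or.inr ⟨i, rfl⟩)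
    let y : Fin (n + 1) → K := fun i => ψ ⟨a i, haR i⟩
    have hy0 : y 0 ≠ 0 := by
      intro h0
      have h1 : (⟨a 0, haR 0⟩ : R) * ⟨(a 0)⁻¹, Algebra.subset_adjoin (Or.inl rfl)⟩ = 1 :=
        Subtype.ext (mul_inv_cancel₀ ha0)
      have h2 := congrArg ψ h1
      rw [map_mul, map_one, show ψ ⟨a 0, haR 0⟩ = 0 from h0, zero_mul] at h2
      exact zero_ne_one h2
    have hy : ∑ i, c i * y i ^ p = 0 := by
      have h1 : ∑ i, c i • (⟨a i, haR i⟩ : R) ^ p = 0 := by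
        apply Subtype.ext
        simpa using hc
      have h2 := congrArg ψ h1
      rw [map_sum, map_zero] at h2
      simpa only [map_smul, map_pow, smul_eq_mul] using h2
    have hc0 : c 0 = -∑ i : Fin n, c i.succ * (y i.succ / y 0) ^ p := by
      rw [Fin.sum_univ_succ] at hy
      have h3 : y 0 ^ p ≠ 0 := pow_ne_zero _ hy0
      apply mul_right_cancel₀ h3
      rw [eq_neg_of_add_eq_zero_left hy, neg_mul, Finset.sum_mul]
      congr 1
      refine Finset.sum_congr rfl fun i _ => ?_
      rw [div_pow, mul_assoc, div_mul_cancel₀ _ h3]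
    have hsucc := ih (fun i => a i.succ - (y i.succ / y 0) • a 0) (by
      rw [Fintype.linearIndependent_iff] at ha ⊢
      intro d hd i
      have := ha (Fin.cons (-∑ i, d i * (y i.succ / y 0)) d) (by
        rw [Fin.sum_univ_succ, ← hd]
        simp only [Fin.cons_zero, Fin.cons_succ, smul_sub, Finset.sum_sub_distrib, smul_smul,
          neg_smul, Finset.sum_smul]
        ring) i.succ
      simpa using this) (fun i => c i.succ) (by
      rw [Fin.sum_univ_succ, hc0] at hc
      rw [← hc]
      simp only [sub_pow_expChar, smul_sub, Finset.sum_sub_distrib, smul_pow, smul_smul, neg_smul,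
        Finset.sum_smul]
      ring)
    have hs : ∀ i : Fin n, c i.succ = 0 := fun i => congrFun hsucc i
    ext i
    refine Fin.cases ?_ hs i
    rw [hc0]
    simp [hs]

theorem IsExistentiallyClosedIn.exists_separating_transcendenceBasis
    (h : IsExistentiallyClosedIn K F) [Algebra.EssFiniteType K F] :
    ∃ s : Finset F, IsTranscendenceBasis K ((↑) : s → F) ∧
      Algebra.IsSeparable (IntermediateField.adjoin K (s : Set F)) F := by
  obtain _ | ⟨p, hp, hpk⟩ := CharP.exists' K
  · exact exists_isTranscendenceBasis_and_isSeparable_of_perfectField K F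
  have : ExpChar K p := .prime hp.out
  refine exists_isTranscendenceBasis_and_isSeparable_of_linearIndepOn_pow_of_essFiniteType
    p hp.out fun s hs => ?_
  have h1 : LinearIndependent K (fun i : Fin s.card => ((s.equivFin.symm i : s) : F)) :=
    hs.comp _ s.equivFin.symm.injective
  have h2 : LinearIndependent K (fun i : Fin s.card => ((s.equivFin.symm i : s) : F) ^ p) := by
    rw [Fintype.linearIndependent_iff]
    intro c hc i
    exact congrFun (h.eq_zero_of_sum_smul_pow_eq_zero p _ h1 c hc) i
  have h3 := h2.comp _ s.equivFin.injective
  simp only [Function.comp_def, Equiv.symm_apply_apply] at h3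
  exact h3

end ExistentiallyClosed

/-! ### Separating bases and primitive elements. -/

section SeparableGeneration

open IntermediateField

theorem exists_algebraicIndependent_adjoin_simple_eq_top {k : Type u} {E : Type v} [Field k]
    [Field E] [Algebra k E] [Algebra.EssFiniteType k E] (s : Finset E)
    (hs : IsTranscendenceBasis k ((↑) : s → E)) [Algebra.IsSeparable (adjoin k (s : Set E)) E]
    {r : ℕ} (hr : (r : Cardinal.{v}) ≤ Algebra.trdeg k E) :
    ∃ (m : ℕ) (x : Fin (r + m) → E) (y : E), AlgebraicIndependent k x ∧
      IsSeparable (adjoin k (Set.range x)) y ∧ (adjoin k (Set.range x))⟮y⟯ = ⊤ := by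
  rw [← hs.cardinalMk_eq_trdeg] at hr
  have hr' : r ≤ s.card := by simpa using hr
  obtain ⟨m, hm⟩ := Nat.exists_eq_add_of_le hr'
  let f : Fin (r + m) ≃ s := (finCongr hm.symm).trans s.equivFin.symm
  have hrange : Set.range (fun i => (f i : E)) = s := by
    ext a
    constructor
    · rintro ⟨i, rfl⟩
      exact (f i).2
    · intro ha
      exact ⟨f.symm ⟨a, ha⟩, by simp⟩
  have : Algebra.EssFiniteType (adjoin k (s : Set E)) E :=
    Algebra.EssFiniteType.of_comp k (adjoin k (s : Set E)) E
  have hfin : FiniteDimensional (adjoin k (s : Set E)) E :=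
    Algebra.finite_of_essFiniteType_of_isAlgebraic
  obtain ⟨y, hy⟩ := Field.exists_primitive_element (adjoin k (s : Set E)) E
  refine ⟨m, fun i => f i, y, hs.1.comp _ f.injective, ?_, ?_⟩
  · rw [hrange]
    exact Algebra.IsSeparable.isSeparable _ y
  · rw [hrange]
    exact hy

end SeparableGeneration

/-! ### Values of algebraic elements and finite index. -/

section ValueGroups

variable {Γ : Type w} [AddCommGroup Γ] [LinearOrder Γ] [IsOrderedAddMonoid Γ]

/-- In a vanishing polynomial expression the minimal value is attained by two terms. Comparing them
makes a positive multiple of `g` the value of a quotient of two coefficients. -/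
theorem AddValuation.exists_nsmul_eq_of_isAlgebraic {F L : Type*} [Field F] [Field L] [Algebra F L]
    (v : AddValuation L (WithTop Γ)) {t : L} (ht : IsAlgebraic F t) {g : Γ}
    (hg : v t = (g : WithTop Γ)) :
    ∃ n : ℕ, 0 < n ∧ ∃ a : F, v (algebraMap F L a) = ((n • g : Γ) : WithTop Γ) := by
  classical
  obtain ⟨q, hq0, hq⟩ := ht
  have hvF : ∀ a : F, a ≠ 0 → ∃ d : Γ, v (algebraMap F L a) = (d : WithTop Γ) := by
    intro a ha
    have h1 : v (algebraMap F L a) ≠ ⊤ := (v.ne_top_iff).mpr (by simpa using ha)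
    exact ⟨_, (WithTop.coe_untop _ h1).symm⟩
  choose! d hd using hvF
  have hterm : ∀ i ∈ q.support, v (algebraMap F L (q.coeff i) * t ^ i) =
      ((d (q.coeff i) + i • g : Γ) : WithTop Γ) := by
    intro i hi
    rw [v.map_mul, v.map_pow, hd _ (Polynomial.mem_support_iff.mp hi), hg]
    rfl
  have hsum : ∑ i ∈ q.support, algebraMap F L (q.coeff i) * t ^ i = 0 := by
    rw [← hq, Polynomial.aeval_eq_sum_range, Finset.sum_subset
      (Polynomial.supp_subset_range_natDegree_succ)]
    · simp [Algebra.smul_def]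
    · intro i _ hi
      simp [Polynomial.notMem_support_iff.mp hi]
  obtain ⟨i, hi, hmin⟩ := q.support.exists_min_image (fun i => d (q.coeff i) + i • g)
    (Polynomial.support_nonempty.mpr hq0)
  obtain ⟨j, hj, hji, hle⟩ : ∃ j ∈ q.support, j ≠ i ∧
      d (q.coeff j) + j • g ≤ d (q.coeff i) + i • g := by
    by_contra! hcon
    rw [← Finset.add_sum_erase _ _ hi] at hsum
    have h1 := v.map_lt_sum (s := q.support.erase i)
      (f := fun i => algebraMap F L (q.coeff i) * t ^ i)
      (g := ((d (q.coeff i) + i • g : Γ) : WithTop Γ)) WithTop.coe_ne_top (by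
        intro j hj
        rw [hterm j (Finset.mem_of_mem_erase hj)]
        exact_mod_cast hcon j (Finset.mem_of_mem_erase hj) (Finset.ne_of_mem_erase hj))
    rw [← neg_eq_of_add_eq_zero_right hsum, v.map_neg, hterm i hi] at h1
    exact h1.false
  have heq : d (q.coeff j) + j • g = d (q.coeff i) + i • g := le_antisymm hle (hmin j hj)
  have hdiv : ∀ a b : F, a ≠ 0 → b ≠ 0 →
      v (algebraMap F L (a / b)) = ((d a - d b : Γ) : WithTop Γ) := by
    intro a b ha hb
    have h1 : v (algebraMap F L (a / b)) + v (algebraMap F L b) = v (algebraMap F L a) := by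
      rw [← v.map_mul, ← RingHom.map_mul, div_mul_cancel₀ _ hb]
    rw [hd a ha, hd b hb, hd _ (div_ne_zero ha hb)] at h1
    rw [hd _ (div_ne_zero ha hb)]
    congr 1
    rw [eq_sub_iff_add_eq]
    exact_mod_cast h1
  have hci := Polynomial.mem_support_iff.mp hi
  have hcj := Polynomial.mem_support_iff.mp hj
  rcases lt_or_gt_of_ne hji with h | h
  · refine ⟨i - j, Nat.sub_pos_of_lt h, q.coeff j / q.coeff i, ?_⟩
    rw [hdiv _ _ hcj hci]
    congr 1
    rw [sub_eq_iff_eq_add, ← add_right_cancel_iff (a := j • g), heq, add_right_comm, ← add_nsmul,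
      Nat.sub_add_cancel h.le, add_comm]
  · refine ⟨j - i, Nat.sub_pos_of_lt h, q.coeff i / q.coeff j, ?_⟩
    rw [hdiv _ _ hci hcj]
    congr 1
    rw [sub_eq_iff_eq_add, ← add_right_cancel_iff (a := i • g), ← heq, add_right_comm, ← add_nsmul,
      Nat.sub_add_cancel h.le, add_comm]

/-- The quotient is a finitely generated torsion abelian group, hence finite. -/
theorem AddSubgroup.finiteIndex_of_nsmul_mem {G : Type*} [AddCommGroup G] {ι : Type*} [Finite ι]
    {g : ι → G} (hg : AddSubgroup.closure (Set.range g) = ⊤) (H : AddSubgroup G)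
    (h : ∀ i, ∃ n : ℕ, 0 < n ∧ n • g i ∈ H) : H.FiniteIndex := by
  have hall : ∀ a : G, ∃ n : ℕ, 0 < n ∧ n • a ∈ H := by
    intro a
    have ha : a ∈ AddSubgroup.closure (Set.range g) := hg ▸ AddSubgroup.mem_top a
    induction ha using AddSubgroup.closure_induction with
    | mem a ha =>
      obtain ⟨i, rfl⟩ := ha
      exact h i
    | zero => exact ⟨1, one_pos, by simp⟩
    | add a b _ _ ha hb =>
      obtain ⟨n, hn, ha⟩ := ha
      obtain ⟨m, hm, hb⟩ := hb
      refine ⟨m * n, Nat.mul_pos hm hn, ?_⟩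
      rw [nsmul_add]
      refine add_mem ?_ ?_
      · rw [mul_nsmul']; exact nsmul_mem ha m
      · rw [mul_nsmul]; exact nsmul_mem hb n
    | neg a _ ha =>
      obtain ⟨n, hn, ha⟩ := ha
      exact ⟨n, hn, by rw [smul_neg]; exact neg_mem ha⟩
  have hfg : AddGroup.FG G := AddGroup.fg_iff.mpr ⟨Set.range g, hg, Set.finite_range g⟩
  have : Finite (G ⧸ H) := AddCommGroup.finite_of_fg_isAddTorsion _ (by
    intro q
    obtain ⟨a, rfl⟩ := QuotientAddGroup.mk_surjective q
    obtain ⟨n, hn, ha⟩ := hall a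
    rw [isOfFinAddOrder_iff_nsmul_eq_zero]
    refine ⟨n, hn, ?_⟩
    rw [← QuotientAddGroup.mk_nsmul]
    exact (QuotientAddGroup.eq_zero_iff _).mpr ha)
  exact AddSubgroup.finiteIndex_of_finite_quotient

end ValueGroups

/-! ### Rational places over an existentially closed field. -/

section Rational

open IntermediateField

variable {Γ : Type w} [AddCommGroup Γ] [LinearOrder Γ] [IsOrderedAddMonoid Γ]
  {K : Type u} {F : Type v} [Field K] [Field F] [Algebra K F]

theorem IsExistentiallyClosedIn.exists_rational_place (hF : IsAlgebraicFunctionField K F)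
    {r : ℕ} (hr : 1 ≤ r) (hrs : (r : Cardinal.{v}) ≤ Algebra.trdeg K F)
    (e : Γ ≃+ (Fin r → ℤ)) (h : IsExistentiallyClosedIn K F) (T : Finset F)
    (hT : ∀ a ∈ T, a ≠ 0) :
    ∃ p : PlaceOver K F, (p.residueField = ⊥ ∧
      (∃ v : AddValuation F (WithTop Γ), p.IsAssociatedValuation v ∧ valuedSubgroup v = ⊤) ∧
      ∃ b : F, b ≠ 0 ∧ p.place b = ((0 : p.codomain) : OnePoint p.codomain)) ∧
      ∀ a ∈ T, p.place a ≠ ((0 : p.codomain) : OnePoint p.codomain) ∧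
        p.place a ≠ OnePoint.infty := by
  have : Algebra.EssFiniteType K F := IntermediateField.fg_top_iff.mp hF.1
  obtain ⟨s, hs, hsep⟩ := h.exists_separating_transcendenceBasis
  obtain ⟨m, x, y, hx, hy, htop⟩ := exists_algebraicIndependent_adjoin_simple_eq_top s hs hrs
  obtain ⟨g, hpos, hg, H⟩ := exists_pos_generators_forall_exists_algHom_hahnSeries hr e
  obtain ⟨R, hR, H⟩ := H x hx y hy T (fun a ha => ⟨hT a ha, htop ▸ mem_top⟩)
  obtain ⟨ψ⟩ := h.nonempty_algHom R hR
  -- A copy of `K` in the universe of `F`, as the codomain of a `PlaceOver` requires.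
  let κ := (⊥ : IntermediateField K F)
  obtain ⟨Φ, hΦT, hΦx⟩ := H (((botEquiv K F).symm.toAlgHom.comp ψ : R →ₐ[K] κ))
  have hmem : ∀ a : F, a ∈ ((adjoin K (Set.range x))⟮y⟯).restrictScalars K := fun a => by
    rw [mem_restrictScalars, htop]; exact mem_top
  let Ψ : F →ₐ[K] HahnSeries Γ κ := Φ.comp
    ((AlgHom.id K F).codRestrict (((adjoin K (Set.range x))⟮y⟯).restrictScalars K).toSubalgebra hmem)
  have hsingle : ∀ i, ∃ b : F, HahnSeries.addVal Γ κ (Ψ b) = (g i : WithTop Γ) := by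
    intro i
    obtain ⟨c, hc⟩ := hΦx i
    -- Since `c` comes from `K`, the constant can be subtracted inside `F`, leaving exactly the
    -- monomial of value `g i`.
    refine ⟨x (Fin.castAdd m i) - algebraMap K F ((botEquiv K F) c), ?_⟩
    have h1 : Ψ (x (Fin.castAdd m i)) =
        HahnSeries.C c + HahnSeries.single (g i) 1 := hc ⟨_, hmem _⟩ rfl
    have h2 : Ψ (algebraMap K F ((botEquiv K F) c)) = HahnSeries.C c := by
      rw [Ψ.commutes, HahnSeries.algebraMap_apply]
      congr 1
      exact (botEquiv K F).symm_apply_apply c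
    rw [map_sub, h1, h2, add_sub_cancel_left]
    exact HahnSeries.orderTop_single one_ne_zero
  refine ⟨PlaceOver.ofHahnSeries Ψ, ⟨?_, ⟨_, PlaceOver.isAssociatedValuation_ofHahnSeries Ψ, ?_⟩, ?_⟩,
    ?_⟩
  · rw [eq_bot_iff]
    intro c _
    refine mem_bot.mpr ⟨(botEquiv K F) c, ?_⟩
    exact (botEquiv K F).symm_apply_apply c
  · rw [eq_top_iff, ← hg, AddSubgroup.closure_le]
    rintro _ ⟨i, rfl⟩
    exact hsingle i
  · obtain ⟨b, hb⟩ := hsingle ⟨0, hr⟩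
    refine ⟨b, ?_, (PlaceOver.ofHahnSeries_place_eq_zero Ψ b).mpr ?_⟩
    · rintro rfl
      rw [map_zero, AddValuation.map_zero] at hb
      exact WithTop.top_ne_coe hb
    · rw [hb]
      exact_mod_cast hpos _
  · intro a ha
    have h0 : HahnSeries.addVal Γ κ (Ψ a) = 0 := hΦT ⟨a, hmem a⟩ ha
    exact ⟨fun h1 => ((PlaceOver.ofHahnSeries_place_eq_zero Ψ a).mp h1).ne' h0,
      (PlaceOver.ofHahnSeries_place_ne_infty Ψ a).mpr h0.ge⟩

end Rational

/-! ### Separable generation after a finite extension of constants. -/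

section DescentOfConstants

open IntermediateField

variable {K : Type u} {Ω : Type v} [Field K] [Field Ω] [Algebra K Ω]

/-- Finitely many elements of fields generated over an extension `L` of `K` already lie in the
fields generated over `K` and finitely many elements of `L`. -/
theorem IntermediateField.exists_finset_forall_mem_adjoin (L : IntermediateField K Ω) (S : Set Ω)
    (B : Finset Ω) (hB : ∀ b ∈ B, b ∈ adjoin L S) :
    ∃ T : Finset Ω, (T : Set Ω) ⊆ L ∧ ∀ b ∈ B, b ∈ adjoin K ((T : Set Ω) ∪ S) := by
  classical
  have h1 : ∀ b : Ω, ∃ T : Finset Ω, (T : Set Ω) ⊆ L ∧ (b ∈ B → b ∈ adjoin K ((T : Set Ω) ∪ S)) := by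
    intro b
    by_cases hb : b ∈ B
    · have h2 : b ∈ adjoin K ((L : Set Ω) ∪ S) := by
        rw [← restrictScalars_adjoin]
        exact hB b hb
      obtain ⟨T, hT, hbT⟩ := exists_finset_of_mem_adjoin h2
      refine ⟨T.filter (· ∈ L), fun t ht => (Finset.mem_filter.mp ht).2, fun _ => ?_⟩
      refine adjoin.mono K _ _ (fun t ht => ?_) hbT
      rcases hT ht with h | h
      · exact Or.inl (Finset.mem_filter.mpr ⟨ht, h⟩)
      · exact Or.inr h
    · exact ⟨∅, by simp, fun h => absurd h hb⟩
  choose T hT hbT using h1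
  refine ⟨B.biUnion T, ?_, fun b hb => ?_⟩
  · intro t ht
    obtain ⟨b, _, h⟩ := Finset.mem_biUnion.mp ht
    exact hT b h
  · refine adjoin.mono K _ _ (Set.union_subset_union_left _ ?_) (hbT b hb)
    exact Finset.coe_subset.mpr (Finset.subset_biUnion_of_mem T hb)

/-- Separability is witnessed by one polynomial, whose finitely many coefficients involve finitely
many constants. Allowing any larger `T'` lets the result be combined with other finiteness
conditions. -/
theorem Polynomial.Separable.exists_finset_isSeparable_adjoin (L : IntermediateField K Ω)
    (S : Set Ω) {P : Polynomial Ω} (hP : P.Separable) (hPc : ∀ i, P.coeff i ∈ adjoin L S) {y : Ω}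
    (hy : P.eval y = 0) :
    ∃ T : Finset Ω, (T : Set Ω) ⊆ L ∧ ∀ T' : Finset Ω, T ⊆ T' →
      IsSeparable (adjoin (adjoin K (T' : Set Ω)) S) y := by
  classical
  obtain ⟨T, hTL, hT⟩ := exists_finset_forall_mem_adjoin L S (P.support.image P.coeff) (by
      intro b hb
      obtain ⟨i, -, rfl⟩ := Finset.mem_image.mp hb
      exact hPc i)
  refine ⟨T, hTL, fun T' hTT' => ?_⟩
  set M := adjoin (adjoin K (T' : Set Ω)) S
  have hcoeff : ∀ i, P.coeff i ∈ Set.range (algebraMap M Ω) := by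
    intro i
    by_cases hi : P.coeff i = 0
    · exact ⟨0, by rw [hi, map_zero]⟩
    · have h1 := hT _ (Finset.mem_image_of_mem _ (Polynomial.mem_support_iff.mpr hi))
      have h2 : P.coeff i ∈ M := by
        rw [← mem_restrictScalars K, adjoin_adjoin_left]
        exact adjoin.mono K _ _ (Set.union_subset_union_left _ (Finset.coe_subset.mpr hTT')) h1
      exact ⟨⟨_, h2⟩, rfl⟩
  obtain ⟨Q, hQ⟩ := (Polynomial.lifts_iff_coeff_lifts P).mpr hcoeff
  have hQ' : Q.map (algebraMap M Ω) = P := hQ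
  have hsep : Q.Separable := by
    rw [← Polynomial.separable_map (algebraMap M Ω), hQ']
    exact hP
  have hroot : Polynomial.aeval y Q = 0 := by
    rw [← Polynomial.aeval_map_algebraMap Ω, hQ', Polynomial.coe_aeval_eq_eval, hy]
  exact hsep.of_dvd (minpoly.dvd M y hroot)

/-- The Nullstellensatz in Zariski's form, applied to a maximal ideal. -/
theorem IntermediateField.exists_finite_residueField {k : Type u} {Ω : Type v} [Field k] [Field Ω]
    [Algebra k Ω] (R : Subalgebra k Ω) (hR : R.FG) :
    ∃ (κ : Type v) (_ : Field κ) (_ : Algebra k κ), FiniteDimensional k κ ∧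
      Nonempty (R →ₐ[k] κ) := by
  obtain ⟨M, hM⟩ := Ideal.exists_maximal R
  have : Algebra.FiniteType k R := R.fg_iff_finiteType.mp hR
  have : Algebra.FiniteType k (R ⧸ M) := .of_surjective (Ideal.Quotient.mkₐ k M)
    (Ideal.Quotient.mkₐ_surjective k M)
  let _ : Field (R ⧸ M) := Ideal.Quotient.field M
  exact ⟨R ⧸ M, inferInstance, inferInstance, finite_of_finite_type_of_isJacobsonRing k (R ⧸ M),
    ⟨Ideal.Quotient.mkₐ k M⟩⟩

/-- After a finite extension of constants inside an algebraically closed field, every function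
field is contained in a separably generated one. -/
theorem exists_finite_constantExtension_separablyGenerated {F : Type v} [Field F] [Algebra K F]
    [IsAlgClosed Ω] (hF : (⊤ : IntermediateField K F).FG) (f : F →ₐ[K] Ω)
    {r : ℕ} (hr : (r : Cardinal.{v}) ≤ Algebra.trdeg K F) :
    ∃ (k : IntermediateField K Ω) (m : ℕ) (x : Fin (r + m) → Ω) (y : Ω),
      FiniteDimensional K k ∧ AlgebraicIndependent k x ∧
      IsSeparable (adjoin k (Set.range x)) y ∧
      ∀ a : F, f a ∈ (adjoin k (Set.range x))⟮y⟯ := by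
  classical
  obtain ⟨G, hG⟩ := hF
  -- Over the perfect field `L` separable generation is automatic; the rest of the proof descends
  -- from `L` to a finite extension of `K`.
  let L : IntermediateField K Ω := algebraicClosure K Ω
  have : IsAlgClosure K L := algebraicClosure.isAlgClosure K Ω
  have : IsAlgClosed L := IsAlgClosure.isAlgClosed K
  have hrange : ∀ {k : IntermediateField K Ω} (E : IntermediateField k Ω), (f '' G ⊆ E) →
      ∀ a, f a ∈ E := by
    intro k E hE a
    have h1 : f a ∈ (adjoin K (G : Set F)).map f := ⟨a, by rw [hG]; exact mem_top, rfl⟩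
    rw [adjoin_map] at h1
    have h2 : adjoin K (f '' G) ≤ E.restrictScalars K := adjoin_le_iff.mpr hE
    exact h2 h1
  let E : IntermediateField L Ω := adjoin L (f '' G)
  have hfE : ∀ a, f a ∈ E := hrange E (subset_adjoin _ _)
  have hEfg : Algebra.EssFiniteType L E := essFiniteType_iff.mpr
    ⟨G.image f, by rw [Finset.coe_image]⟩
  obtain ⟨s, hs, hsep⟩ := exists_isTranscendenceBasis_and_isSeparable_of_perfectField L E
  have htr : (r : Cardinal.{v}) ≤ Algebra.trdeg L E := by
    obtain ⟨t, ht⟩ := exists_isTranscendenceBasis K F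
    rw [← ht.cardinalMk_eq_trdeg] at hr
    refine hr.trans ?_
    have h1 : AlgebraicIndependent K fun i : t => f i := ht.1.map' f.injective
    have h2 : AlgebraicIndependent L fun i : t => f i := h1.extendScalars L
    have h3 : AlgebraicIndependent L fun i : t => (⟨f i, hfE i⟩ : E) := by
      refine AlgebraicIndependent.of_comp E.val ?_
      exact h2
    exact h3.cardinalMk_le_trdeg
  obtain ⟨m, x, y, hx, hy, htop⟩ := exists_algebraicIndependent_adjoin_simple_eq_top s hs htr
  have hadj : ∀ S : Set E, (adjoin L S).map E.val = adjoin L (((↑) : E → Ω) '' S) := fun S =>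
    adjoin_map L S E.val
  have hrx : ((↑) : E → Ω) '' (Set.range x) = Set.range fun i => (x i : Ω) := by
    rw [← Set.range_comp]; rfl
  let φ : adjoin L (Set.range x) →+* Ω :=
    (algebraMap E Ω).comp (algebraMap (adjoin L (Set.range x)) E)
  have hφ : ∀ c, φ c ∈ adjoin L (Set.range fun i => (x i : Ω)) := by
    intro c
    have : φ c ∈ (adjoin L (Set.range x)).map E.val := ⟨c, c.2, rfl⟩
    rwa [hadj, hrx] at this
  obtain ⟨T1, hT1L, hT1⟩ := Polynomial.Separable.exists_finset_isSeparable_adjoin L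
    (Set.range fun i => (x i : Ω)) (P := (minpoly (adjoin L (Set.range x)) y).map φ)
    (Polynomial.Separable.map hy) (fun i => by rw [Polynomial.coeff_map]; exact hφ _)
    (y := (y : Ω)) (by
      rw [← Polynomial.map_map, Polynomial.eval_map_algebraMap]
      refine (Polynomial.aeval_algebraMap_apply Ω y _).trans ?_
      rw [Polynomial.aeval_map_algebraMap, minpoly.aeval, map_zero])
  obtain ⟨T2, hT2L, hT2⟩ := exists_finset_forall_mem_adjoin L
    ((Set.range fun i => (x i : Ω)) ∪ {(y : Ω)}) (G.image f) (by
      intro b hb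
      obtain ⟨a, -, rfl⟩ := Finset.mem_image.mp hb
      have h1 : (⟨f a, hfE a⟩ : E) ∈ ((adjoin L (Set.range x))⟮y⟯).restrictScalars L := by
        rw [htop]; exact mem_top
      rw [adjoin_adjoin_left] at h1
      have h2 : f a ∈ (adjoin L (Set.range x ∪ {y})).map E.val := ⟨_, h1, rfl⟩
      rw [hadj, Set.image_union, hrx, Set.image_singleton] at h2
      exact h2)
  -- `T1` keeps `y` separable, and `T2` suffices to express the generators of `F`.
  let k := adjoin K ((T1 ∪ T2 : Finset Ω) : Set Ω)
  have hkL : k ≤ L := by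
    rw [adjoin_le_iff, Finset.coe_union]
    exact Set.union_subset hT1L hT2L
  have hkfin : FiniteDimensional K k := by
    refine finiteDimensional_adjoin fun t ht => ?_
    exact (mem_algebraicClosure_iff.mp (hkL (subset_adjoin _ _ ht))).isIntegral
  refine ⟨k, m, fun i => x i, y, hkfin, ?_, hT1 _ Finset.subset_union_left, ?_⟩
  · have h1 : AlgebraicIndependent L fun i => E.val (x i) :=
      AlgebraicIndependent.map' (f := E.val) hx E.val.injective
    have h2 : AlgebraicIndependent K fun i => (x i : Ω) :=
      h1.restrictScalars (algebraMap K L).injective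
    have : Algebra.IsAlgebraic K k := Algebra.IsAlgebraic.of_finite K k
    exact h2.extendScalars k
  · refine hrange (k := k) (((adjoin k (Set.range fun i => (x i : Ω)))⟮(y : Ω)⟯).restrictScalars k) ?_
    rintro _ ⟨a, ha, rfl⟩
    have h1 := hT2 _ (Finset.mem_image_of_mem f ha)
    rw [adjoin_adjoin_left, SetLike.mem_coe, ← mem_restrictScalars K, adjoin_adjoin_left]
    refine adjoin.mono K _ _ (Set.union_subset_union_left _ ?_) h1
    exact Finset.coe_subset.mpr Finset.subset_union_right

end DescentOfConstants

/-! ### Places with finite residue extension and value group of finite index. -/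

section FinitePlaces

open IntermediateField

variable {Γ : Type w} [AddCommGroup Γ] [LinearOrder Γ] [IsOrderedAddMonoid Γ]
  {K : Type u} {F : Type v} [Field K] [Field F] [Algebra K F]

/-- The constant `c` need not lie in `F`, but it is algebraic over `K`, so `t` is algebraic over the
image of `F`. -/
theorem HahnSeries.exists_nsmul_eq_addVal {κ : Type v} [Field κ] [Algebra K κ]
    [FiniteDimensional K κ] (Ψ : F →ₐ[K] HahnSeries Γ κ) (c : κ) (t : HahnSeries Γ κ) {g : Γ}
    (hg : HahnSeries.addVal Γ κ t = (g : WithTop Γ)) (q : Polynomial F) (hq0 : q ≠ 0)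
    (hq : q.eval₂ (Ψ : F →+* HahnSeries Γ κ) (HahnSeries.C c + t) = 0) :
    ∃ n : ℕ, 0 < n ∧ ∃ a : F, HahnSeries.addVal Γ κ (Ψ a) = ((n • g : Γ) : WithTop Γ) := by
  let _ : Algebra F (HahnSeries Γ κ) := (Ψ : F →+* HahnSeries Γ κ).toAlgebra
  have : IsScalarTower K F (HahnSeries Γ κ) := IsScalarTower.of_algebraMap_eq' Ψ.comp_algebraMap.symm
  have : IsScalarTower K κ (HahnSeries Γ κ) := IsScalarTower.of_algebraMap_eq fun _ => rfl
  have h1 : IsAlgebraic F (HahnSeries.C c + t) := ⟨q, hq0, hq⟩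
  have h2 : IsAlgebraic K (algebraMap κ (HahnSeries Γ κ) c) :=
    (Algebra.IsAlgebraic.isAlgebraic (R := K) c).algebraMap
  have h3 : IsAlgebraic F (HahnSeries.C c : HahnSeries Γ κ) := IsAlgebraic.tower_top F h2
  have h4 : IsAlgebraic F t := by
    have := h1.sub h3
    rwa [add_sub_cancel_left] at this
  exact (HahnSeries.addVal Γ κ).exists_nsmul_eq_of_isAlgebraic h4 hg

theorem exists_finite_place (hF : IsAlgebraicFunctionField K F)
    {r : ℕ} (hr : 1 ≤ r) (hrs : (r : Cardinal.{v}) ≤ Algebra.trdeg K F)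
    (e : Γ ≃+ (Fin r → ℤ)) (T : Finset F) (hT : ∀ a ∈ T, a ≠ 0) :
    ∃ p : PlaceOver K F, (FiniteDimensional K p.residueField ∧
      (∃ v : AddValuation F (WithTop Γ), p.IsAssociatedValuation v ∧
        (valuedSubgroup v).FiniteIndex) ∧
      ∃ b : F, b ≠ 0 ∧ p.place b = ((0 : p.codomain) : OnePoint p.codomain)) ∧
      ∀ a ∈ T, p.place a ≠ ((0 : p.codomain) : OnePoint p.codomain) ∧
        p.place a ≠ OnePoint.infty := by
  classical
  let Ω := AlgebraicClosure F
  let f : F →ₐ[K] Ω := IsScalarTower.toAlgHom K F Ω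
  obtain ⟨k, m, x, y, hk, hx, hy, hf⟩ := exists_finite_constantExtension_separablyGenerated hF.1 f hrs
  obtain ⟨g, hpos, hg, H⟩ := exists_pos_generators_forall_exists_algHom_hahnSeries hr e
  obtain ⟨R, hR, H⟩ := H x hx y hy (T.image f) (fun b hb => by
    obtain ⟨a, ha, rfl⟩ := Finset.mem_image.mp hb
    exact ⟨(map_ne_zero f).mpr (hT a ha), hf a⟩)
  obtain ⟨κ, _, _, hκ, ⟨ψ⟩⟩ := exists_finite_residueField R hR
  obtain ⟨Φ, hΦT, hΦx⟩ := H ψ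
  let _ : Algebra K κ := ((algebraMap k κ).comp (algebraMap K k)).toAlgebra
  have : IsScalarTower K k κ := IsScalarTower.of_algebraMap_eq fun _ => rfl
  have hKκ : FiniteDimensional K κ := FiniteDimensional.trans K k κ
  let E := ((adjoin k (Set.range x))⟮y⟯).restrictScalars k
  let j : F →+* E := (f : F →+* Ω).codRestrict E.toSubfield hf
  let Ψ : F →ₐ[K] HahnSeries Γ κ := { (Φ : E →+* HahnSeries Γ κ).comp j with
    commutes' := fun c => by
      have h1 : j (algebraMap K F c) = algebraMap k E (algebraMap K k c) :=
        Subtype.ext (f.commutes c)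
      change Φ (j (algebraMap K F c)) = _
      rw [h1, Φ.commutes]
      rfl }
  have hΨ : ∀ a, Ψ a = Φ (j a) := fun a => rfl
  have hmul : ∀ i, ∃ n : ℕ, 0 < n ∧ ∃ a : F, HahnSeries.addVal Γ κ (Ψ a) =
      ((n • g i : Γ) : WithTop Γ) := by
    intro i
    obtain ⟨c, hc⟩ := hΦx i
    have hxE : x (Fin.castAdd m i) ∈ E := by
      change x (Fin.castAdd m i) ∈ ((adjoin k (Set.range x))⟮y⟯).restrictScalars k
      rw [adjoin_adjoin_left]
      exact subset_adjoin _ _ (Or.inl ⟨_, rfl⟩)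
    -- The `x i` need not lie in `F`, but they lie in its algebraic closure `Ω`; the algebraic
    -- relation is carried over by `Φ`.
    obtain ⟨q, hq0, hq⟩ := Algebra.IsAlgebraic.isAlgebraic (R := F) (x (Fin.castAdd m i))
    have h1 : q.eval₂ j (⟨x (Fin.castAdd m i), hxE⟩ : E) = 0 := by
      apply Subtype.ext
      have h2 := Polynomial.hom_eval₂ q j (algebraMap E Ω) ⟨x (Fin.castAdd m i), hxE⟩
      exact h2.trans hq
    have h3 := Polynomial.hom_eval₂ q j (Φ : E →+* HahnSeries Γ κ) ⟨x (Fin.castAdd m i), hxE⟩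
    rw [h1, map_zero] at h3
    refine HahnSeries.exists_nsmul_eq_addVal Ψ c (HahnSeries.single (g i) 1)
      (HahnSeries.orderTop_single one_ne_zero) q hq0 ?_
    rw [← hc ⟨x (Fin.castAdd m i), hxE⟩ rfl]
    exact h3.symm
  refine ⟨PlaceOver.ofHahnSeries Ψ, ⟨?_, ⟨_, PlaceOver.isAssociatedValuation_ofHahnSeries Ψ, ?_⟩, ?_⟩,
    ?_⟩
  · have : FiniteDimensional K (PlaceOver.ofHahnSeries Ψ).codomain := hKκ
    infer_instance
  · exact AddSubgroup.finiteIndex_of_nsmul_mem hg _ hmul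
  · obtain ⟨n, hn, b, hb⟩ := hmul ⟨0, hr⟩
    refine ⟨b, ?_, (PlaceOver.ofHahnSeries_place_eq_zero Ψ b).mpr ?_⟩
    · rintro rfl
      rw [map_zero, AddValuation.map_zero] at hb
      exact WithTop.top_ne_coe hb
    · rw [hb]
      exact_mod_cast nsmul_pos (hpos _) hn.ne'
  · intro a ha
    have h0 : HahnSeries.addVal Γ κ (Ψ a) = 0 := hΦT (j a) (Finset.mem_image_of_mem f ha)
    exact ⟨fun h1 => ((PlaceOver.ofHahnSeries_place_eq_zero Ψ a).mp h1).ne' h0,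
      (PlaceOver.ofHahnSeries_place_ne_infty Ψ a).mpr h0.ge⟩

end FinitePlaces

/-! ### Conclusion. -/

theorem theorem2p3 {K : Type u} {F : Type v} [Field K] [Field F] [Algebra K F]
    (hF : IsAlgebraicFunctionField K F)
    (r : ℕ) (hr : 1 ≤ r) (hrs : (r : Cardinal.{v}) ≤ Algebra.trdeg K F)
    {Γ : Type w} [AddCommGroup Γ] [LinearOrder Γ] [IsOrderedAddMonoid Γ]
    (e : Γ ≃+ (Fin r → ℤ))
    (m : ℕ) (a : Fin m → F) (ha : ∀ i, a i ≠ 0) :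
    (∃ lam : ℕ → PlaceOver K F,
      Pairwise (fun i j => ¬ (lam i).Equivalent (lam j)) ∧
      ∀ n,
        FiniteDimensional K (lam n).residueField ∧
        (∃ v : AddValuation F (WithTop Γ), (lam n).IsAssociatedValuation v ∧
          (valuedSubgroup v).FiniteIndex) ∧
        ∀ i, (lam n).place (a i) ≠ ((0 : (lam n).codomain) : OnePoint (lam n).codomain) ∧
          (lam n).place (a i) ≠ OnePoint.infty) ∧
    (IsExistentiallyClosedIn K F →
      ∃ lam : ℕ → PlaceOver K F,
        Pairwise (fun i j => ¬ (lam i).Equivalent (lam j)) ∧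
        ∀ n,
          (lam n).residueField = ⊥ ∧
          (∃ v : AddValuation F (WithTop Γ), (lam n).IsAssociatedValuation v ∧
            valuedSubgroup v = ⊤) ∧
          ∀ i, (lam n).place (a i) ≠ ((0 : (lam n).codomain) : OnePoint (lam n).codomain) ∧
            (lam n).place (a i) ≠ OnePoint.infty) := by
  constructor
  -- The property carries an extra clause, that some nonzero element is sent to zero; it drives the
  -- avoidance and is then dropped.
  · obtain ⟨lam, h1, h2⟩ := PlaceOver.exists_seq_pairwise_not_equivalent _ (fun p hp => hp.2.2)
      (exists_finite_place hF hr hrs e) a ha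
    exact ⟨lam, h1, fun n => ⟨(h2 n).1.1, (h2 n).1.2.1, (h2 n).2⟩⟩
  · intro hK
    obtain ⟨lam, h1, h2⟩ := PlaceOver.exists_seq_pairwise_not_equivalent _ (fun p hp => hp.2.2)
      (hK.exists_rational_place hF hr hrs e) a ha
    exact ⟨lam, h1, fun n => ⟨(h2 n).1.1, (h2 n).1.2.1, (h2 n).2⟩⟩
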